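/- Let $0\le m<n$ be integers. A collector draws with replacement, independently and uniformly, from $n$ distinct coupons; let $W_{n,m}$ be the number of draws after which, for the first time, $n-m$ distinct coupons have been collected. Put $\widetilde W_{n,m}=W_{n,m}-(n-m)$, $\sigma_n^2=\operatorname{Var}W_{n,m}$, $c=\lfloor \operatorname{Var}\widetilde W_{n,m}-\mathbb E\widetilde W_{n,m}\rfloor$, let $\mu=\mathcal D(\widetilde W_{n,m}+c)$ be the law of $\widetilde W_{n,m}+c$ on $\mathbb Z$, and let $$a_{n,j}=\sum_{k=m+1}^n\Big(\frac{n-k}{k}\Big)^j,\qquad j=1,2,\dots$$ For an integer $R\ge 3$ define the polynomials $$h_R(w)=-(a_{n,2}-\lfloor a_{n,2}\rfloor)\,w+(a_{n,2}-\lfloor a_{n,2}\rfloor)\frac{w^2}{2}+\sum_{r=3}^R\big(a_{n,r}+(-1)^{r+1}\lfloor a_{n,2}\rfloor\big)\frac{w^r}{r},\qquad H_R(w)=\sum_{l=0}^R\frac{h_R(w)^l}{l!}=\sum_{r=0}^{R^2}\widetilde a^{(r)}w^r .$$ When $\sigma_n^2>0$, let $\nu_R$ be the finite signed measure concentrated on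 the nonnegative integers whose Fourier–Stieltjes transform is $\sum_{k}e^{itk}\nu_R\{k\}=\exp\{\sigma_n^2(e^{it}-1)\}\,H_R(e^{it}-1)$, $t\in\mathbb R$; that is, the Poisson–Charlier signed measure $$\nu_R\{j\}=e^{-\sigma_n^2}\frac{(\sigma_n^2)^j}{j!}\sum_{r=0}^{R^2}(-1)^r\,\widetilde a^{(r)}\,C_r(j,\sigma_n^2),\quad j=0,1,2,\dots,\qquad C_r(j,\lambda)=\sum_{k=0}^r(-1)^k\binom rk\binom jk k!\,\lambda^{-k}.$$ Theorem. For every integer $R\ge3$ there exist thresholds $m_R,n_R$ and a constant $C_R>0$, all depending only on $R$, such that for all integers $m<n$ with $m\ge m_R$, $n\ge n_R$ and $a_{n,2}>1$, $$\sup_{k\in\mathbb Z}|\mu\{k\}-\nu_R\{k\}|\le C_R\Big(\frac1{\sqrt m}\Big)^{R}\quad\text{if } m\le \frac n2-1,$$ and $$\sup_{k\in\mathbb Z}|\mu\{k\}-\nu_R\{k\}|\le C_R\,\frac{(\sqrt n)^{R-2}}{(n-m)^{R-1}}\quad\text{if } m\ge \frac n2 .$$ -/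

import Mathlib

open MeasureTheory ProbabilityTheory Polynomial

/-! ### The coupon collector's waiting time -/

/-- `couponWait n m x`: the number of draws made when, in the sequence of draws `x 0, x 1, x 2, …`
from `n` coupons, `n - m` distinct coupons have been collected for the first time.
(It is `0` for the sequences in which this never happens; under independent uniform draws these
form a null event.) -/
noncomputable def couponWait (n m : ℕ) (x : ℕ → Fin n) : ℕ :=
  sInf {t : ℕ | n - m ≤ ((Finset.range t).image x).card}

/-- The shifted waiting time `W - (n - m)`. -/
noncomputable def shiftedWait (n m : ℕ) (x : ℕ → Fin n) : ℤ :=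
  (couponWait n m x : ℤ) - ((n : ℤ) - (m : ℤ))

/-- `X 0, X 1, X 2, …` are independent draws with replacement, each of them uniform on `n`
coupons. -/
structure IsUniformSampling {Ω : Type*} [MeasurableSpace Ω] (P : Measure Ω) (n : ℕ)
    (X : ℕ → Ω → Fin n) : Prop where
  measurable : ∀ i, Measurable (X i)
  indep : iIndepFun X P
  uniform : ∀ i (a : Fin n), P.real {ω | X i ω = a} = 1 / (n : ℝ)

/-- The variance `σ²` of the waiting time. -/
noncomputable def waitVar {Ω : Type*} [MeasurableSpace Ω] (P : Measure Ω) {n : ℕ} (m : ℕ)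
    (X : ℕ → Ω → Fin n) : ℝ :=
  variance (fun ω => (couponWait n m (fun i => X i ω) : ℝ)) P

/-- The translation `c`, the integer part of `Var W̃ - E W̃` for the shifted waiting time `W̃`. -/
noncomputable def shiftConst {Ω : Type*} [MeasurableSpace Ω] (P : Measure Ω) {n : ℕ} (m : ℕ)
    (X : ℕ → Ω → Fin n) : ℤ :=
  ⌊variance (fun ω => (shiftedWait n m (fun i => X i ω) : ℝ)) P
    - ∫ ω, (shiftedWait n m (fun i => X i ω) : ℝ) ∂P⌋

/-- The law, on the integers, of the translated waiting time `W̃ + c`. -/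
noncomputable def couponLaw {Ω : Type*} [MeasurableSpace Ω] (P : Measure Ω) {n : ℕ} (m : ℕ)
    (X : ℕ → Ω → Fin n) : Measure ℤ :=
  P.map (fun ω => shiftedWait n m (fun i => X i ω) + shiftConst P m X)

/-! ### Poisson–Charlier signed measures -/

/-- The Charlier polynomial `C_r(j, lam)`. -/
noncomputable def charlier (r j : ℕ) (lam : ℝ) : ℝ :=
  ∑ k ∈ Finset.range (r + 1),
    (-1) ^ k * (r.choose k : ℝ) * (j.choose k : ℝ) * (k.factorial : ℝ) / lam ^ k

/-- The density, with respect to the Poisson law with parameter `lam`, of the Poisson–Charlier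
signed measure with coefficients `a_r = p.coeff r`. -/
noncomputable def pcDensity (lam : ℝ) (p : ℝ[X]) (j : ℕ) : ℝ :=
  ∑ r ∈ Finset.range (p.natDegree + 1), (-1) ^ r * p.coeff r * charlier r j lam

/-- The Poisson–Charlier signed measure with parameter `lam` and coefficients `p.coeff r`,
concentrated on the nonnegative integers and regarded as a signed measure on `ℤ`. For `0 < lam` its
Fourier–Stieltjes transform is `exp (lam * (e^{it} - 1)) * p (e^{it} - 1)`; see
`hasSum_poissonCharlier`. -/
noncomputable def poissonCharlier (lam : NNReal) (p : ℝ[X]) : SignedMeasure ℤ :=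
  ((poissonMeasure lam).withDensityᵥ (pcDensity lam p)).map (fun j : ℕ => (j : ℤ))

/-! ### The expansion -/

/-- `a_{n,j} = ∑_{k=m+1}^n ((n-k)/k)^j`. -/
noncomputable def aCoef (n m j : ℕ) : ℝ :=
  ∑ k ∈ Finset.Icc (m + 1) n, (((n : ℝ) - (k : ℝ)) / (k : ℝ)) ^ j

/-- The polynomial `h_R`. -/
noncomputable def hPoly (n m R : ℕ) : ℝ[X] :=
  - C (aCoef n m 2 - (⌊aCoef n m 2⌋ : ℝ)) * X
    + C ((aCoef n m 2 - (⌊aCoef n m 2⌋ : ℝ)) / 2) * X ^ 2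
    + ∑ r ∈ Finset.Icc 3 R,
        C ((aCoef n m r + (-1) ^ (r + 1) * (⌊aCoef n m 2⌋ : ℝ)) / (r : ℝ)) * X ^ r

/-- The polynomial `H_R = ∑_{l=0}^R h_R^l / l!`. -/
noncomputable def HPoly (n m R : ℕ) : ℝ[X] :=
  ∑ l ∈ Finset.range (R + 1), C (1 / (l.factorial : ℝ)) * hPoly n m R ^ l

/-- The approximating signed measure `ν_R`: the Poisson–Charlier signed measure whose
Poisson parameter is the variance of the waiting time and whose coefficients are those of `H_R`. -/
noncomputable def nuR {Ω : Type*} [MeasurableSpace Ω] (P : Measure Ω) {n : ℕ} (m : ℕ)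
    (X : ℕ → Ω → Fin n) (R : ℕ) : SignedMeasure ℤ :=
  poissonCharlier (waitVar P m X).toNNReal (HPoly n m R)

/-! ### The Poisson–Charlier signed measures are well defined and have the stated transform -/

theorem hasSum_poisson_choose (lam : NNReal) (hlam : 0 < lam) (k : ℕ) (z : ℂ) :
    HasSum (fun j : ℕ => (Complex.exp (-(lam : ℝ)) * ((lam : ℝ) : ℂ) ^ j / (j.factorial : ℂ))
        * ((j.choose k : ℂ) * (k.factorial : ℂ) / ((lam : ℝ) : ℂ) ^ k) * z ^ j)
      (z ^ k * Complex.exp ((lam : ℝ) * (z - 1))) := by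
  have hl : ((lam : ℝ) : ℂ) ≠ 0 := by
    have : (lam : ℝ) ≠ 0 := by positivity
    exact_mod_cast this
  have h0 : HasSum (fun i : ℕ => (((lam : ℝ) : ℂ) * z) ^ i / (i.factorial : ℂ))
      (Complex.exp ((lam : ℝ) * z)) := by
    rw [Complex.exp_eq_exp_ℂ]
    exact NormedSpace.expSeries_div_hasSum_exp _
  have h1 := (h0.mul_left (Complex.exp (-(lam : ℝ)) * z ^ k))
  have hv : Complex.exp (-(lam : ℝ)) * z ^ k * Complex.exp ((lam : ℝ) * z)
      = z ^ k * Complex.exp ((lam : ℝ) * (z - 1)) := by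
    rw [mul_comm (Complex.exp _) (z ^ k), mul_assoc, ← Complex.exp_add]
    congr 2
    ring
  rw [hv] at h1
  have hinj : Function.Injective (fun i : ℕ => i + k) := add_left_injective k
  rw [← hinj.hasSum_iff]
  · convert! h1 using 1
    funext i
    simp only [Function.comp_apply]
    have hc : ((i + k).choose k : ℂ) * (k.factorial : ℂ) * (i.factorial : ℂ)
        = ((i + k).factorial : ℂ) := by
      have := Nat.add_choose_mul_factorial_mul_factorial i k
      have h3 : (i + k).choose k * k.factorial * i.factorial = (i + k).factorial := by
        rw [← this]; ring
      exact_mod_cast h3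
    have hf1 : (i.factorial : ℂ) ≠ 0 := by exact_mod_cast i.factorial_ne_zero
    have hf2 : ((i + k).factorial : ℂ) ≠ 0 := by exact_mod_cast (i + k).factorial_ne_zero
    rw [← hc] at hf2 ⊢
    have hf3 : ((i + k).choose k : ℂ) * (k.factorial : ℂ) ≠ 0 := left_ne_zero_of_mul hf2
    have hf4 : ((i + k).choose k : ℂ) ≠ 0 := left_ne_zero_of_mul hf3
    have hf5 : (k.factorial : ℂ) ≠ 0 := right_ne_zero_of_mul hf3
    field_simp
    ring
  · intro j hj
    have : j < k := by
      by_contra h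
      exact hj ⟨j - k, by simp only; omega⟩
    simp [Nat.choose_eq_zero_of_lt this]

theorem hasSum_poisson_pcDensity (lam : NNReal) (hlam : 0 < lam) (p : ℝ[X]) (z : ℂ) :
    HasSum (fun j : ℕ => (Complex.exp (-(lam : ℝ)) * ((lam : ℝ) : ℂ) ^ j / (j.factorial : ℂ))
        * (pcDensity lam p j : ℂ) * z ^ j)
      (Complex.exp ((lam : ℝ) * (z - 1)) * (p.map (algebraMap ℝ ℂ)).eval (z - 1)) := by
  have h := hasSum_sum (s := Finset.range (p.natDegree + 1))
    (fun r _ => (hasSum_sum (s := Finset.range (r + 1))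
      (fun k _ => (hasSum_poisson_choose lam hlam k z).mul_left
        ((-1) ^ k * (r.choose k : ℂ)))).mul_left ((-1) ^ r * (p.coeff r : ℂ)))
  convert! h using 1
  · funext j
    simp only [pcDensity, charlier]
    push_cast
    rw [Finset.mul_sum, Finset.sum_mul]
    refine Finset.sum_congr rfl fun r _ => ?_
    rw [Finset.mul_sum, Finset.mul_sum, Finset.mul_sum, Finset.sum_mul]
    refine Finset.sum_congr rfl fun k _ => ?_
    ring
  · rw [Polynomial.eval_eq_sum_range, Polynomial.natDegree_map, Finset.mul_sum]
    refine Finset.sum_congr rfl fun r _ => ?_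
    have hb : (z - 1) ^ r = (-1) ^ r * ∑ k ∈ Finset.range (r + 1),
        (-1) ^ k * (r.choose k : ℂ) * z ^ k := by
      have : z - 1 = (-1) * (-z + 1) := by ring
      rw [this, mul_pow, add_pow]
      congr 1
      refine Finset.sum_congr rfl fun k _ => ?_
      rw [neg_pow z]
      ring
    rw [hb, Polynomial.coeff_map, Finset.mul_sum, Finset.mul_sum, Finset.mul_sum, Finset.mul_sum]
    refine Finset.sum_congr rfl fun k _ => ?_
    simp only [Complex.coe_algebraMap]
    ring

theorem integrable_pcDensity (lam : NNReal) (hlam : 0 < lam) (p : ℝ[X]) :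
    Integrable (pcDensity lam p) (poissonMeasure lam) := by
  rw [integrable_poissonMeasure_iff]
  have h := (hasSum_poisson_pcDensity lam hlam p 1).summable.norm
  refine h.congr fun j => ?_
  have e : (Complex.exp (-(lam : ℝ)) * ((lam : ℝ) : ℂ) ^ j / (j.factorial : ℂ))
      = ((Real.exp (-lam) * (lam : ℝ) ^ j / (j.factorial : ℝ) : ℝ) : ℂ) := by
    push_cast; rfl
  rw [one_pow, mul_one, norm_mul, e, Complex.norm_real, Complex.norm_real,
    Real.norm_of_nonneg (by positivity)]

/-- The point masses of a Poisson–Charlier signed measure at the nonnegative integers. -/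
theorem poissonCharlier_natCast (lam : NNReal) (hlam : 0 < lam) (p : ℝ[X]) (j : ℕ) :
    poissonCharlier lam p {(j : ℤ)} = (poissonMeasure lam).real {j} * pcDensity lam p j := by
  have hpre : (fun j : ℕ => (j : ℤ)) ⁻¹' {(j : ℤ)} = {j} := by
    ext i; simp
  rw [poissonCharlier, VectorMeasure.map_apply _ (by fun_prop) (measurableSet_singleton _), hpre,
    withDensityᵥ_apply (integrable_pcDensity lam hlam p) (measurableSet_singleton _),
    integral_singleton, smul_eq_mul]

/-- A Poisson–Charlier signed measure does not charge the negative integers. -/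
theorem poissonCharlier_of_neg (lam : NNReal) (p : ℝ[X]) {k : ℤ} (hk : k < 0) :
    poissonCharlier lam p {k} = 0 := by
  have hpre : (fun j : ℕ => (j : ℤ)) ⁻¹' {k} = ∅ := by
    ext i
    simp only [Set.mem_preimage, Set.mem_singleton_iff, Set.mem_empty_iff_false, iff_false]
    omega
  rw [poissonCharlier, VectorMeasure.map_apply _ (by fun_prop) (measurableSet_singleton _), hpre,
    VectorMeasure.empty]

/-- The Fourier–Stieltjes transform of a Poisson–Charlier signed measure. -/
theorem hasSum_poissonCharlier (lam : NNReal) (hlam : 0 < lam) (p : ℝ[X]) (t : ℝ) :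
    HasSum (fun k : ℤ => Complex.exp (Complex.I * t * k) * (poissonCharlier lam p {k} : ℂ))
      (Complex.exp ((lam : ℝ) * (Complex.exp (Complex.I * t) - 1))
        * (p.map (algebraMap ℝ ℂ)).eval (Complex.exp (Complex.I * t) - 1)) := by
  have h := hasSum_poisson_pcDensity lam hlam p (Complex.exp (Complex.I * t))
  have hinj : Function.Injective (fun j : ℕ => (j : ℤ)) := Nat.cast_injective
  rw [← hinj.hasSum_iff]
  · convert! h using 1
    funext j
    simp only [Function.comp_apply]
    rw [poissonCharlier_natCast lam hlam, poissonMeasure_real_singleton, ← Complex.exp_nat_mul]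
    push_cast
    rw [mul_comm (Complex.I * (t : ℂ)) (j : ℂ)]
    ring
  · intro k hk
    have : k < 0 := by
      by_contra h
      exact hk ⟨k.toNat, by simp only; omega⟩
    simp [poissonCharlier_of_neg lam p this]

/-! ### Fourier inversion -/

/-! The waiting time is a sum of independent geometric variables, so with `w = e^{it} - 1`, `x_k =
(n-k)/k` and `c = ⌊a_{n,2}⌋` the translated law has transform `(1+w)^c ∏ (1 - x_k w)⁻¹`
(`hasSum_couponLaw`). The coefficient of `w^r` in its logarithm is `(a_{n,r} + (-1)^{r+1} c)/r`.
Since `σ² = a_{n,1} + a_{n,2}`, the terms up to degree `R` are exactly `σ² w + h_R(w)`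
(`exists_log_expansion`), and the choice of `c` leaves only a fractional part in degrees 1 and 2.
Hence the transform is `exp(σ² w) exp(h_R + E)`, where `E` is the logarithmic remainder, while that
of `ν_R` is `exp(σ² w) H_R` with `H_R` a truncation of `exp(h_R)`.

The point masses are compared by Fourier inversion (`norm_le_integral_of_hasSum_exp`). Let `B ≥ 1`
bound all `x_k`. On the unit circle `Re w = -|w|²/2`, so `exp(σ² w)` has Gaussian modulus. Where
`B|w| ≤ 1/16`, the errors `E` and `h_R^{R+1}/(R+1)!` are of order `|w|^{R+1}`, up to powers of `1 +
σ²|w|²` absorbed by the Gaussian (`exists_norm_transform_sub_le_of_small`). Each factor `|w|` is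
worth `1/σ`, and integrating the Gaussian gives one more. Where `B|w| ≥ 1/16`, both transforms are
at most a constant times `exp(-σ²/(1024 B²))` (`norm_prod_inv_le`, `exists_norm_exp_mul_HPoly_le`).
Together these give `exists_abs_couponLaw_sub_nuR_le`.

The two rates come from taking `B = n/m` when `m ≤ n/2` and `B = 1` when `m ≥ n/2`, and inserting
elementary bounds for `a_{n,1}` and `a_{n,2}`. -/

theorem integral_exp_I_mul_int (l : ℤ) :
    ∫ t in (-Real.pi)..Real.pi, Complex.exp (Complex.I * t * l)
      = if l = 0 then 2 * (Real.pi : ℂ) else 0 := by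
  split_ifs with h
  · subst h
    simp
    ring
  · have hc : Complex.I * (l : ℂ) ≠ 0 := by simp [h]
    have := integral_exp_mul_complex (a := -Real.pi) (b := Real.pi) hc
    have e : ∀ t : ℝ, Complex.exp (Complex.I * t * l) = Complex.exp (Complex.I * l * t) := by
      intro t; congr 1; ring
    simp_rw [e, this]
    have : Complex.exp (Complex.I * l * (Real.pi : ℝ))
        = Complex.exp (Complex.I * l * ((-Real.pi : ℝ) : ℂ)) := by
      rw [Complex.exp_eq_exp_iff_exists_int]
      exact ⟨l, by push_cast; ring⟩
    rw [this]; simp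

/-- Integrating the series against `e^{-itk}` term by term isolates `2π d_k`. A pointwise majorant
of the transform on one period therefore bounds every mass at once. -/
theorem norm_le_integral_of_hasSum_exp {d : ℤ → ℂ} {F : ℝ → ℂ}
    (hF : ∀ t : ℝ, HasSum (fun k : ℤ => Complex.exp (Complex.I * t * k) * d k) (F t))
    {g : ℝ → ℝ} (hg : Continuous g) (h : ∀ t : ℝ, |t| ≤ Real.pi → ‖F t‖ ≤ g t) (k : ℤ) :
    ‖d k‖ ≤ 1 / (2 * Real.pi) * ∫ t in (-Real.pi)..Real.pi, g t := by
  have hpi := Real.pi_pos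
  -- At `t = 0` the hypothesis says that `d` itself is summable, and in `ℂ` this is absolute
  -- summability.
  have hd : Summable fun j => ‖d j‖ := by
    have := (hF 0).summable.norm
    simpa using this
  let f : ℤ → C(ℝ, ℂ) := fun j =>
    ⟨fun t => Complex.exp (Complex.I * t * ((j - k : ℤ) : ℂ)) * d j, by fun_prop⟩
  have hnorm : ∀ (t : ℝ) (j : ℤ), ‖Complex.exp (Complex.I * t * (j : ℂ))‖ = 1 := by
    intro t j
    have : Complex.I * t * (j : ℂ) = ((t * j : ℝ) : ℂ) * Complex.I := by push_cast; ring
    rw [this, Complex.norm_exp_ofReal_mul_I]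
  have hs := intervalIntegral.hasSum_intervalIntegral_of_summable_norm (f := f)
    (a := -Real.pi) (b := Real.pi) (by
      refine Summable.of_nonneg_of_le (fun _ => norm_nonneg _) (fun j => ?_) hd
      refine (ContinuousMap.norm_le _ (norm_nonneg _)).2 fun t => ?_
      simp only [f, ContinuousMap.restrict_apply, ContinuousMap.coe_mk, norm_mul, hnorm, one_mul,
        le_refl])
  have e1 : ∀ j, ∫ t in (-Real.pi)..Real.pi, f j t = if j = k then 2 * (Real.pi : ℂ) * d k else 0 := by
    intro j
    simp only [f, ContinuousMap.coe_mk]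
    rw [intervalIntegral.integral_mul_const, integral_exp_I_mul_int]
    by_cases hjk : j = k
    · simp [hjk]
    · simp [hjk, sub_eq_zero]
  have e2 : ∀ t : ℝ, ∑' j, f j t = Complex.exp (-(Complex.I * t * k)) * F t := by
    intro t
    rw [← (hF t).tsum_eq, ← tsum_mul_left]
    refine tsum_congr fun j => ?_
    simp only [f, ContinuousMap.coe_mk]
    rw [← mul_assoc, ← Complex.exp_add]
    congr 2
    push_cast; ring
  simp only [e1, e2] at hs
  have hu := hs.unique (hasSum_ite_eq k (2 * (Real.pi : ℂ) * d k))
  have hb : ‖2 * (Real.pi : ℂ) * d k‖ ≤ ∫ t in (-Real.pi)..Real.pi, g t := by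
    rw [← hu]
    refine intervalIntegral.norm_integral_le_of_norm_le (by linarith) ?_
      (hg.intervalIntegrable _ _)
    refine Filter.Eventually.of_forall fun t ht => ?_
    have h1 : ‖Complex.exp (-(Complex.I * t * k))‖ = 1 := by
      have := hnorm t (-k)
      rw [← this]; congr 2; push_cast; ring
    rw [norm_mul, h1, one_mul]
    exact h t (abs_le.2 ⟨ht.1.le, ht.2⟩)
  rw [norm_mul, norm_mul, Complex.norm_real, Real.norm_of_nonneg hpi.le] at hb
  rw [div_mul_eq_mul_div, one_mul, le_div_iff₀ (by positivity)]
  simp only [Complex.norm_ofNat] at hb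
  linarith

/-! ### Elementary bounds -/

theorem exists_one_add_pow_mul_exp_neg_le (p : ℕ) {κ : ℝ} (hκ : 0 < κ) :
    ∃ K : ℝ, 0 < K ∧ ∀ x : ℝ, 0 ≤ x → (1 + x) ^ p * Real.exp (-(κ * x)) ≤ K := by
  refine ⟨Real.exp κ * p.factorial / κ ^ p, by positivity, fun x hx => ?_⟩
  have h := Real.pow_div_factorial_le_exp (κ * (1 + x)) (by positivity) p
  rw [div_le_iff₀ (by positivity), mul_pow] at h
  rw [le_div_iff₀ (by positivity)]
  have e : Real.exp (κ * (1 + x)) = Real.exp κ * Real.exp (κ * x) := by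
    rw [← Real.exp_add]; congr 1; ring
  rw [e] at h
  calc (1 + x) ^ p * Real.exp (-(κ * x)) * κ ^ p
      = (κ ^ p * (1 + x) ^ p) * Real.exp (-(κ * x)) := by ring
    _ ≤ (Real.exp κ * Real.exp (κ * x) * p.factorial) * Real.exp (-(κ * x)) := by gcongr
    _ = Real.exp κ * p.factorial * (Real.exp (κ * x) * Real.exp (-(κ * x))) := by ring
    _ = Real.exp κ * p.factorial := by rw [← Real.exp_add]; simp

theorem exp_half_le_one_add {x : ℝ} (hx : 0 ≤ x) (hx1 : x ≤ 1) : Real.exp (x / 2) ≤ 1 + x := by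
  have h := Real.exp_bound_div_one_sub_of_interval (x := x / 2) (by linarith) (by linarith)
  refine h.trans ?_
  rw [div_le_iff₀ (by linarith)]
  nlinarith

theorem re_eq_of_norm_one_add {w : ℂ} (hw : ‖1 + w‖ = 1) : w.re = -(‖w‖ ^ 2 / 2) := by
  have h : ‖1 + w‖ ^ 2 = 1 := by rw [hw]; norm_num
  rw [Complex.sq_norm, Complex.normSq_apply] at h ⊢
  simp at h
  nlinarith

/-- Expand the square and use `Re w = -|w|²/2`. The coefficient `x + x²` is the variance of the
corresponding geometric variable, so a product of these factors decays at a rate governed by `σ²`.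
-/
theorem norm_one_sub_mul_sq {w : ℂ} (hw : ‖1 + w‖ = 1) (x : ℝ) :
    ‖1 - x * w‖ ^ 2 = 1 + (x + x ^ 2) * ‖w‖ ^ 2 := by
  have h := re_eq_of_norm_one_add hw
  simp only [Complex.sq_norm, Complex.normSq_apply] at h ⊢
  simp
  linear_combination (-2 * x) * h

theorem norm_exp_ofReal_mul {w : ℂ} (hw : ‖1 + w‖ = 1) (s : ℝ) :
    ‖Complex.exp (s * w)‖ = Real.exp (-(s * ‖w‖ ^ 2 / 2)) := by
  rw [Complex.norm_exp]
  simp [re_eq_of_norm_one_add hw]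
  ring

theorem norm_exp_I_sub_one_ge {t : ℝ} (ht : |t| ≤ Real.pi) :
    |t| / 2 ≤ ‖Complex.exp (Complex.I * t) - 1‖ := by
  have h1 := Real.mul_abs_le_abs_sin (x := t / 2) (by rw [abs_div, abs_two]; linarith)
  rw [Complex.norm_exp_I_mul_ofReal_sub_one, norm_mul, Real.norm_eq_abs, Real.norm_eq_abs]
  have h2 : (1:ℝ) / 2 ≤ 2 / Real.pi := by
    rw [div_le_div_iff₀ (by norm_num) Real.pi_pos]; linarith [Real.pi_le_four]
  have h3 : 1 / 2 * |t / 2| ≤ 2 / Real.pi * |t / 2| := by gcongr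
  rw [abs_two]
  rw [abs_div, abs_two] at h3 h1
  linarith

theorem norm_one_add_exp_I_sub_one (t : ℝ) : ‖1 + (Complex.exp (Complex.I * t) - 1)‖ = 1 := by
  rw [add_sub_cancel, mul_comm, Complex.norm_exp_ofReal_mul_I]

/-! ### The mass function of the waiting time -/

/-- The mass function, at `t`, of the number of draws needed to collect `j` distinct coupons out
of `n`. -/
noncomputable def waitMass (n : ℕ) : ℕ → ℕ → ℝ
  | 0, 0 => 1
  | 0, _ + 1 => 0
  | _ + 1, 0 => 0
  | j + 1, t + 1 => (j / n : ℝ) * waitMass n (j + 1) t + (1 - j / n : ℝ) * waitMass n j t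

theorem waitMass_succ_succ (n j t : ℕ) : waitMass n (j + 1) (t + 1) =
    (j / n : ℝ) * waitMass n (j + 1) t + (1 - j / n : ℝ) * waitMass n j t := by
  rw [waitMass]

theorem waitMass_succ_zero (n j : ℕ) : waitMass n (j + 1) 0 = 0 := by
  rw [waitMass]

theorem waitMass_zero_succ (n t : ℕ) : waitMass n 0 (t + 1) = 0 := by
  rw [waitMass]

theorem waitMass_zero_zero (n : ℕ) : waitMass n 0 0 = 1 := by
  rw [waitMass]

theorem waitMass_nonneg {n j : ℕ} (hj : j ≤ n) (t : ℕ) : 0 ≤ waitMass n j t := by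
  induction t generalizing j with
  | zero => cases j <;> simp [waitMass]
  | succ t ih =>
    cases j with
    | zero => simp [waitMass]
    | succ j =>
      rw [waitMass_succ_succ]
      have h1 : (j / n : ℝ) ≤ 1 := by
        apply div_le_one_of_le₀ _ (by positivity)
        exact_mod_cast (by omega : j ≤ n)
      have := ih hj
      have := ih (j := j) (by omega)
      have : (0:ℝ) ≤ 1 - j / n := by linarith
      positivity

/-- Summing the recursion bounds `(1 - α)` times any partial sum by `u 0` plus the total of the
positive part of `v`. This gives finite moments before the moment equations are solved. -/
theorem summable_of_le_mul_add {u v : ℕ → ℝ} {α : ℝ} (hα1 : α < 1)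
    (hu : ∀ t, 0 ≤ u t) (hv : Summable v) (h : ∀ t, u (t + 1) ≤ α * u t + v t) :
    Summable u := by
  have hv0 : ∀ t, 0 ≤ max (v t) 0 := fun t => le_max_right _ _
  have hvs : Summable fun t => max (v t) 0 :=
    Summable.of_nonneg_of_le hv0 (fun t => max_le (le_abs_self _) (abs_nonneg _)) hv.abs
  refine summable_of_sum_range_le (c := (u 0 + ∑' t, max (v t) 0) / (1 - α)) hu fun T => ?_
  rw [le_div_iff₀ (by linarith)]
  have h1 : ∑ t ∈ Finset.range T, u t ≤ ∑ t ∈ Finset.range (T + 1), u t :=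
    Finset.sum_le_sum_of_subset_of_nonneg (Finset.range_mono (by omega)) fun _ _ _ => hu _
  rw [Finset.sum_range_succ'] at h1
  have h2 : ∑ t ∈ Finset.range T, u (t + 1) ≤
      ∑ t ∈ Finset.range T, (α * u t + max (v t) 0) :=
    Finset.sum_le_sum fun t _ => (h t).trans (by gcongr; exact le_max_left _ _)
  rw [Finset.sum_add_distrib, ← Finset.mul_sum] at h2
  have h3 := hvs.sum_le_tsum (Finset.range T) fun t _ => hv0 t
  linarith

/-- The recursion for `waitMass` says that a geometric waiting time of success probability `1 - j/n`
is added at each stage. Multiplying it by `(t+1)^k`, `k = 0, 1, 2`, and summing over `t` gives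
linear equations, solvable since `j < n`. -/
theorem hasSum_waitMass_moments {n j : ℕ} (hj : j ≤ n) :
    HasSum (waitMass n j) 1 ∧
    HasSum (fun t : ℕ => (t : ℝ) * waitMass n j t)
      (∑ i ∈ Finset.range j, (n : ℝ) / (n - i)) ∧
    HasSum (fun t : ℕ => (t : ℝ) ^ 2 * waitMass n j t)
      ((∑ i ∈ Finset.range j, (n : ℝ) / (n - i)) ^ 2
        + ∑ i ∈ Finset.range j, ((i : ℝ) / (n - i) + ((i : ℝ) / (n - i)) ^ 2)) := by
  induction j with
  | zero =>
    refine ⟨?_, ?_, ?_⟩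
    · convert hasSum_single (f := waitMass n 0) 0 ?_ using 1
      · rw [waitMass_zero_zero]
      · rintro (_ | t) ht
        · exact absurd rfl ht
        · exact waitMass_zero_succ n t
    · convert! hasSum_zero (α := ℝ) (β := ℕ) using 1
      funext t; cases t <;> simp [waitMass]
    · simp only [Finset.range_zero, Finset.sum_empty]
      convert! hasSum_zero (α := ℝ) (β := ℕ) using 1
      · funext t; cases t <;> simp [waitMass]
      · norm_num
  | succ j ih =>
    obtain ⟨i0, i1, i2⟩ := ih (by omega)
    have hn : (0 : ℝ) < n := by exact_mod_cast (by omega : 0 < n)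
    have hjn : (j : ℝ) < n := by exact_mod_cast (by omega : j < n)
    have hα : (0 : ℝ) ≤ j / n := by positivity
    have hα1 : (j / n : ℝ) < 1 := (div_lt_one hn).2 hjn
    have hnj : (n : ℝ) - j ≠ 0 := by linarith
    set m1 := ∑ i ∈ Finset.range j, (n : ℝ) / (n - i)
    set V := ∑ i ∈ Finset.range j, ((i : ℝ) / (n - i) + ((i : ℝ) / (n - i)) ^ 2)
    set u := waitMass n (j + 1) with hu
    set w := waitMass n j with hw
    have hu0 : ∀ t, 0 ≤ u t := fun t => waitMass_nonneg hj t
    have hrec : ∀ t, u (t + 1) = (j / n : ℝ) * u t + (1 - j / n : ℝ) * w t := fun t =>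
      waitMass_succ_succ n j t
    have hz : u 0 = 0 := waitMass_succ_zero n j
    have s0 : Summable u := summable_of_le_mul_add hα1 hu0 (i0.summable.mul_left (1 - j / n : ℝ))
      fun t => (hrec t).le
    have hr1 : ∀ t : ℕ, ((t + 1 : ℕ) : ℝ) * u (t + 1) = (j / n : ℝ) * (t * u t)
        + ((j / n : ℝ) * u t + (1 - j / n : ℝ) * (t * w t + w t)) := by
      intro t; rw [hrec]; push_cast; ring
    have s1 : Summable fun t : ℕ => (t : ℝ) * u t :=
      summable_of_le_mul_add hα1 (fun t => mul_nonneg (by positivity) (hu0 t))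
        ((s0.mul_left _).add ((i1.summable.add i0.summable).mul_left (1 - j / n : ℝ)))
        fun t => (hr1 t).le
    have hr2 : ∀ t : ℕ, ((t + 1 : ℕ) : ℝ) ^ 2 * u (t + 1) = (j / n : ℝ) * (t ^ 2 * u t)
        + ((j / n : ℝ) * (2 * (t * u t) + u t)
          + (1 - j / n : ℝ) * (t ^ 2 * w t + 2 * (t * w t) + w t)) := by
      intro t; rw [hrec]; push_cast; ring
    have s2 : Summable fun t : ℕ => (t : ℝ) ^ 2 * u t :=
      summable_of_le_mul_add hα1 (fun t => mul_nonneg (by positivity) (hu0 t))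
        ((((s1.mul_left 2).add s0).mul_left _).add
          (((i2.summable.add (i1.summable.mul_left 2)).add i0.summable).mul_left (1 - j / n : ℝ)))
        fun t => (hr2 t).le
    obtain ⟨A, hA⟩ := s0
    obtain ⟨B, hB⟩ := s1
    obtain ⟨D, hD⟩ := s2
    have e0 : A = j / n * A + (1 - j / n) * 1 := by
      have h1 := (hasSum_nat_add_iff' 1).2 hA
      simp only [hrec, Finset.sum_range_one, hz, sub_zero] at h1
      exact h1.unique ((hA.mul_left _).add (i0.mul_left _))
    have e1 : B = j / n * B + (j / n * A + (1 - j / n) * (m1 + 1)) := by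
      have h1 := (hasSum_nat_add_iff' 1).2 hB
      simp only [hr1, Finset.sum_range_one, hz, sub_zero, mul_zero] at h1
      exact h1.unique ((hB.mul_left _).add ((hA.mul_left _).add ((i1.add i0).mul_left _)))
    have e2 : D = j / n * D + (j / n * (2 * B + A)
        + (1 - j / n) * ((m1 ^ 2 + V) + 2 * m1 + 1)) := by
      have h1 := (hasSum_nat_add_iff' 1).2 hD
      simp only [hr2, Finset.sum_range_one, hz, sub_zero, mul_zero] at h1
      exact h1.unique ((hD.mul_left _).add ((((hB.mul_left 2).add hA).mul_left _).add
        (((i2.add (i1.mul_left 2)).add i0).mul_left _)))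
    have f0 : A = 1 := by
      field_simp at e0
      have : ((n : ℝ) - j) * (A - 1) = 0 := by linarith
      rcases mul_eq_zero.1 this with h | h
      · exact absurd h hnj
      · linarith
    have f1 : B = m1 + n / (n - j) := by
      rw [f0] at e1
      field_simp at e1 ⊢
      linarith
    have f2 : D = (m1 + n / (n - j)) ^ 2 + (V + (j / (n - j) + (j / (n - j)) ^ 2)) := by
      rw [f0, f1] at e2
      field_simp at e2 ⊢
      linear_combination e2
    refine ⟨f0 ▸ hA, ?_, ?_⟩
    · rw [Finset.sum_range_succ, ← f1]; exact hB
    · rw [Finset.sum_range_succ, Finset.sum_range_succ, ← f2]; exact hD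

/-- The recursion turns into `G_{j+1} = z ((j/n) G_{j+1} + (1 - j/n) G_j)` for the generating
functions; solving it contributes the factor `z (1 - (j/(n-j)) (z-1))⁻¹`. -/
theorem hasSum_waitMass_mul_pow {n j : ℕ} (hj : j ≤ n) {z : ℂ} (hz : ‖z‖ = 1) :
    HasSum (fun t : ℕ => z ^ t * (waitMass n j t : ℂ))
      (z ^ j * ∏ i ∈ Finset.range j, (1 - ((i : ℝ) / (n - i) : ℝ) * (z - 1))⁻¹) := by
  have hsum : ∀ j ≤ n, Summable fun t : ℕ => z ^ t * (waitMass n j t : ℂ) := by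
    intro j hj
    refine Summable.of_norm ((hasSum_waitMass_moments hj).1.summable.congr fun t => ?_)
    rw [norm_mul, norm_pow, hz, one_pow, one_mul, Complex.norm_real,
      Real.norm_of_nonneg (waitMass_nonneg hj t)]
  induction j with
  | zero =>
    convert hasSum_single (f := fun t : ℕ => z ^ t * (waitMass n 0 t : ℂ)) 0 ?_ using 1
    · simp [waitMass_zero_zero]
    · rintro (_ | t) ht
      · exact absurd rfl ht
      · simp [waitMass_zero_succ]
  | succ j ih =>
    have i0 := ih (by omega)
    obtain ⟨A, hA⟩ := hsum (j + 1) hj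
    have h1 := (hasSum_nat_add_iff' 1).2 hA
    have hrec : ∀ t : ℕ, z ^ (t + 1) * (waitMass n (j + 1) (t + 1) : ℂ) =
        (j / n * z : ℂ) * (z ^ t * (waitMass n (j + 1) t : ℂ))
          + ((1 - j / n) * z : ℂ) * (z ^ t * (waitMass n j t : ℂ)) := by
      intro t; rw [waitMass_succ_succ]; push_cast; ring
    simp only [hrec, Finset.sum_range_one, waitMass_succ_zero, Complex.ofReal_zero, mul_zero,
      sub_zero] at h1
    have e := h1.unique ((hA.mul_left _).add (i0.mul_left _))
    have hjn : (j : ℝ) < n := by exact_mod_cast (by omega : j < n)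
    have hn : (n : ℂ) ≠ 0 := by exact_mod_cast (by omega : n ≠ 0)
    have hnj : (n : ℂ) - j ≠ 0 := by
      have : (n : ℝ) - j ≠ 0 := by linarith
      exact_mod_cast this
    have hne : (1 - ((j : ℝ) / (n - j) : ℝ) * (z - 1) : ℂ) ≠ 0 := by
      intro h0
      have := norm_one_sub_mul_sq (w := z - 1) (by simpa using hz) ((j : ℝ) / (n - j))
      rw [h0] at this
      have h2 : 0 ≤ (j : ℝ) / (n - j) := div_nonneg (by positivity) (by linarith)
      simp only [norm_zero] at this
      have : 0 ≤ ((j : ℝ) / (n - j) + ((j : ℝ) / (n - j)) ^ 2) * ‖z - 1‖ ^ 2 := by positivity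
      linarith
    rw [Finset.prod_range_succ]
    convert! hA using 1
    rw [← div_eq_mul_inv, ← mul_div_assoc, div_eq_iff hne]
    push_cast
    push_cast at e
    set Q := ∏ i ∈ Finset.range j, (1 - (i : ℂ) / (n - i) * (z - 1))⁻¹
    field_simp at e ⊢
    linear_combination (-1 : ℂ) * e

/-! ### The law of the waiting time -/

/-- The set of coupons collected in the first `t` draws. -/
def drawn {Ω : Type*} {n : ℕ} (X : ℕ → Ω → Fin n) (t : ℕ) (ω : Ω) : Finset (Fin n) :=
  (Finset.range t).image (fun i => X i ω)

section Paths

variable {Ω : Type*} {n : ℕ} {X : ℕ → Ω → Fin n}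

theorem drawn_succ (t : ℕ) (ω : Ω) : drawn X (t + 1) ω = insert (X t ω) (drawn X t ω) := by
  simp [drawn, Finset.range_add_one, Finset.image_insert]

theorem drawn_eq_preimage (t : ℕ) (S : Finset (Fin n)) :
    {ω | drawn X t ω = S} = (fun ω (i : Finset.range t) => X i ω) ⁻¹'
      {f | Finset.univ.image f = S} := by
  ext ω
  have : drawn X t ω = Finset.univ.image (fun i : Finset.range t => X i ω) := by
    ext a
    simp [drawn]
  simp [this]

theorem card_drawn_succ (t : ℕ) (ω : Ω) : (drawn X (t + 1) ω).card
    = if X t ω ∈ drawn X t ω then (drawn X t ω).card else (drawn X t ω).card + 1 := by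
  rw [drawn_succ, Finset.card_insert_eq_ite]

theorem card_drawn_mono (ω : Ω) : Monotone fun t => (drawn X t ω).card :=
  monotone_nat_of_le_succ fun t => by
    simp only [card_drawn_succ]
    split_ifs <;> omega

theorem couponWait_eq_succ_iff (m t : ℕ) (ω : Ω) :
    couponWait n m (fun i => X i ω) = t + 1
      ↔ n - m ≤ (drawn X (t + 1) ω).card ∧ (drawn X t ω).card < n - m := by
  rw [couponWait, Nat.sInf_upward_closed_eq_succ_iff]
  · simp only [Set.mem_ofPred_eq, drawn, not_le]
  · intro k₁ k₂ hk h1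
    exact le_trans h1 (card_drawn_mono (X := X) ω hk)

end Paths

section Law

variable {Ω : Type*} [MeasurableSpace Ω] {P : Measure Ω} {n : ℕ} {X : ℕ → Ω → Fin n}

theorem hasSum_measureReal_eq [IsProbabilityMeasure P] {W : Ω → ℕ} (hW : Measurable W) :
    HasSum (fun t : ℕ => P.real {ω | W ω = t}) 1 := by
  have hp : IsProbabilityMeasure (P.map W) := Measure.isProbabilityMeasure_map hW.aemeasurable
  have h := hasSum_integral_measure (f := fun _ : ℕ => (1 : ℝ))
    (μ := fun t : ℕ => (P.map W {t}) • Measure.dirac t)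
    (by rw [Measure.sum_smul_dirac]; exact integrable_const _)
  rw [Measure.sum_smul_dirac] at h
  convert! h using 1
  · funext t
    simp [measureReal_def, Measure.map_apply hW (measurableSet_singleton t)]
    rfl
  · simp

theorem integrable_comp_and_integral_comp [IsProbabilityMeasure P] {W : Ω → ℕ}
    (hW : Measurable W) {f : ℕ → ℝ} (hf : ∀ t, 0 ≤ f t) {a : ℝ}
    (h : HasSum (fun t : ℕ => f t * P.real {ω | W ω = t}) a) :
    Integrable (fun ω => f (W ω)) P ∧ ∫ ω, f (W ω) ∂P = a := by
  have hp : IsProbabilityMeasure (P.map W) := Measure.isProbabilityMeasure_map hW.aemeasurable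
  have e : ∀ t : ℕ, (P.map W {t}).toReal = P.real {ω | W ω = t} := fun t => by
    rw [Measure.map_apply hW (measurableSet_singleton t)]; rfl
  have hs : Summable fun t : ℕ => (P.map W {t}).toReal * ‖f t‖ := by
    refine h.summable.congr fun t => ?_
    rw [e, Real.norm_of_nonneg (hf t), mul_comm]
  have hc : ∀ t : ℕ, P.map W {t} ≠ ⊤ := fun t => measure_ne_top _ _
  have h1 := integrable_sum_dirac (x := fun t : ℕ => t) hc hs
  have h2 := hasSum_integral_sum_dirac (x := fun t : ℕ => t) hc hs
  rw [Measure.sum_smul_dirac] at h1 h2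
  have hf' : AEStronglyMeasurable f (P.map W) := h1.aestronglyMeasurable
  refine ⟨h1.comp_measurable hW, ?_⟩
  rw [integral_map hW.aemeasurable hf'] at h2
  refine h2.unique ?_
  simpa only [e, smul_eq_mul, mul_comm] using h

theorem measurableSet_drawn_eq (h : ∀ i, Measurable (X i)) (t : ℕ) (S : Finset (Fin n)) :
    MeasurableSet {ω | drawn X t ω = S} := by
  rw [drawn_eq_preimage]
  have hS : MeasurableSet {f : Finset.range t → Fin n | Finset.univ.image f = S} :=
    (Set.toFinite _).measurableSet
  have hf : Measurable (fun ω (i : Finset.range t) => X i ω) :=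
    measurable_pi_lambda _ fun i => h i
  exact hf hS

theorem measureReal_drawn_eq_and_eq [IsProbabilityMeasure P] (h : IsUniformSampling P n X)
    (t : ℕ) (S : Finset (Fin n)) (a : Fin n) :
    P.real {ω | drawn X t ω = S ∧ X t ω = a} = P.real {ω | drawn X t ω = S} * (1 / n) := by
  have hi := h.indep.indepFun_finset (Finset.range t) {t} (by simp) h.measurable
  have := hi.measure_inter_preimage_eq_mul
    {f : Finset.range t → Fin n | Finset.univ.image f = S}
    {f : ({t} : Finset ℕ) → Fin n | f ⟨t, by simp⟩ = a} (Set.toFinite _).measurableSet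
    (Set.toFinite _).measurableSet
  rw [← drawn_eq_preimage] at this
  rw [← h.uniform t a, measureReal_def, measureReal_def, measureReal_def, ← ENNReal.toReal_mul]
  congr 1

/-- Probabilities of events determined by the first `t` draws and the next one. -/
theorem measureReal_drawn_and_next [IsProbabilityMeasure P] (h : IsUniformSampling P n X)
    (t : ℕ) (U : Finset (Finset (Fin n))) (V : Finset (Fin n) → Finset (Fin n)) :
    P.real {ω | drawn X t ω ∈ U ∧ X t ω ∈ V (drawn X t ω)}
      = ∑ S ∈ U, P.real {ω | drawn X t ω = S} * ((V S).card / n) := by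
  have e : {ω | drawn X t ω ∈ U ∧ X t ω ∈ V (drawn X t ω)}
      = ⋃ p ∈ U.sigma V, {ω | drawn X t ω = p.1 ∧ X t ω = p.2} := by
    ext ω
    simp only [Set.mem_ofPred_eq, Set.mem_iUnion, Finset.mem_sigma, exists_prop]
    constructor
    · rintro ⟨h1, h2⟩
      exact ⟨⟨drawn X t ω, X t ω⟩, ⟨h1, h2⟩, rfl, rfl⟩
    · rintro ⟨⟨S, a⟩, ⟨h1, h2⟩, h3, h4⟩
      simp only at h1 h2 h3 h4
      subst h3 h4
      exact ⟨h1, h2⟩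
  rw [e, measureReal_biUnion_finset, Finset.sum_sigma]
  · refine Finset.sum_congr rfl fun S _ => ?_
    simp only [measureReal_drawn_eq_and_eq h, Finset.sum_const, nsmul_eq_mul]
    ring
  · rintro ⟨S, a⟩ _ ⟨S', a'⟩ _ hne
    refine Set.disjoint_left.2 fun ω h1 h2 => hne ?_
    obtain ⟨h1, h1'⟩ := h1
    obtain ⟨h2, h2'⟩ := h2
    simp only at h1 h1' h2 h2'
    subst h1 h1' h2 h2'
    rfl
  · rintro ⟨S, a⟩ _
    exact (measurableSet_drawn_eq h.measurable t S).inter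
      (h.measurable t (measurableSet_singleton a))

theorem measureReal_card_drawn [IsProbabilityMeasure P] (h : ∀ i, Measurable (X i))
    (t j : ℕ) : P.real {ω | (drawn X t ω).card = j}
      = ∑ S ∈ Finset.univ.filter (fun S : Finset (Fin n) => S.card = j),
          P.real {ω | drawn X t ω = S} := by
  have e : {ω | (drawn X t ω).card = j}
      = ⋃ S ∈ Finset.univ.filter (fun S : Finset (Fin n) => S.card = j),
          {ω | drawn X t ω = S} := by
    ext ω; simp
  rw [e, measureReal_biUnion_finset]
  · rintro S _ S' _ hne
    refine Set.disjoint_left.2 fun ω h1 h2 => hne ?_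
    exact h1.symm.trans h2
  · exact fun S _ => measurableSet_drawn_eq h t S

theorem measureReal_card_drawn_and_new [IsProbabilityMeasure P] (h : IsUniformSampling P n X)
    (hn : 0 < n) (t j : ℕ) :
    P.real {ω | (drawn X t ω).card = j ∧ X t ω ∉ drawn X t ω}
      = (1 - j / n) * P.real {ω | (drawn X t ω).card = j} := by
  have := measureReal_drawn_and_next h t
    (Finset.univ.filter (fun S : Finset (Fin n) => S.card = j)) (fun S => Sᶜ)
  simp only [Finset.mem_filter, Finset.mem_univ, true_and, Finset.mem_compl] at this
  rw [this, measureReal_card_drawn h.measurable, Finset.mul_sum]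
  refine Finset.sum_congr rfl fun S hS => ?_
  have hS' : S.card = j := by simpa using hS
  have hle : S.card ≤ n := by simpa using Finset.card_le_univ S
  rw [Finset.card_compl, Fintype.card_fin, Nat.cast_sub hle, hS']
  have : (n : ℝ) ≠ 0 := by exact_mod_cast hn.ne'
  field_simp

theorem measureReal_card_drawn_and_old [IsProbabilityMeasure P] (h : IsUniformSampling P n X)
    (t j : ℕ) :
    P.real {ω | (drawn X t ω).card = j ∧ X t ω ∈ drawn X t ω}
      = (j / n) * P.real {ω | (drawn X t ω).card = j} := by
  have := measureReal_drawn_and_next h t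
    (Finset.univ.filter (fun S : Finset (Fin n) => S.card = j)) (fun S => S)
  simp only [Finset.mem_filter, Finset.mem_univ, true_and] at this
  rw [this, measureReal_card_drawn h.measurable, Finset.mul_sum]
  refine Finset.sum_congr rfl fun S hS => ?_
  have hS' : S.card = j := by simpa using hS
  rw [hS']
  ring

theorem measurableSet_card_drawn (h : ∀ i, Measurable (X i)) (t : ℕ) (p : ℕ → Prop) :
    MeasurableSet {ω | p (drawn X t ω).card} := by
  classical
  have e : {ω | p (drawn X t ω).card}
      = ⋃ S ∈ Finset.univ.filter (fun S : Finset (Fin n) => p S.card),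
          {ω | drawn X t ω = S} := by
    ext ω; simp
  rw [e]
  exact Finset.measurableSet_biUnion _ fun S _ => measurableSet_drawn_eq h t S

/-- The left side is the probability that draw `t` (counted from 0) yields coupon number `j + 1`,
i.e. that `j + 1` coupons take `t + 1` draws. Conditioning on whether the previous draw was new
reproduces the recursion of `waitMass`, so the independence of the geometric stages need not be
established separately. -/
theorem measureReal_card_drawn_eq_waitMass [IsProbabilityMeasure P]
    (h : IsUniformSampling P n X) (hn : 0 < n) (t j : ℕ) :
    (1 - j / n) * P.real {ω | (drawn X t ω).card = j} = waitMass n (j + 1) (t + 1) := by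
  induction t generalizing j with
  | zero =>
    rw [waitMass_succ_succ, waitMass_succ_zero]
    cases j with
    | zero => simp [drawn, waitMass_zero_zero]
    | succ j => simp [drawn, waitMass_succ_zero]
  | succ t ih =>
    rw [waitMass_succ_succ, ← ih]
    cases j with
    | zero =>
      have : {ω | (drawn X (t + 1) ω).card = 0} = ∅ := by
        ext ω; simp [drawn]
      rw [this]
      simp [waitMass_zero_succ, drawn]
    | succ j =>
      rw [← ih]
      have e : {ω | (drawn X (t + 1) ω).card = j + 1}
          = {ω | (drawn X t ω).card = j + 1 ∧ X t ω ∈ drawn X t ω}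
            ∪ {ω | (drawn X t ω).card = j ∧ X t ω ∉ drawn X t ω} := by
        ext ω
        simp only [Set.mem_ofPred_eq, Set.mem_union, card_drawn_succ]
        split_ifs with hx <;> simp [hx]
      have hmeas : MeasurableSet {ω | (drawn X t ω).card = j ∧ X t ω ∉ drawn X t ω} := by
        have : {ω | (drawn X t ω).card = j ∧ X t ω ∉ drawn X t ω}
            = {ω | (drawn X t ω).card = j} ∩ {ω | (drawn X (t + 1) ω).card = j + 1} := by
          ext ω
          simp only [Set.mem_ofPred_eq, Set.mem_inter_iff, card_drawn_succ]
          refine and_congr_right fun h1 => ?_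
          split_ifs with hx <;> simp [hx, h1]
        rw [this]
        exact (measurableSet_card_drawn h.measurable t (· = j)).inter
          (measurableSet_card_drawn h.measurable (t + 1) (· = j + 1))
      rw [e, measureReal_union _ hmeas, measureReal_card_drawn_and_old h,
        measureReal_card_drawn_and_new h hn]
      · ring
      · exact Set.disjoint_left.2 fun ω h1 h2 => h2.2 h1.2

theorem measurable_couponWait (h : ∀ i, Measurable (X i)) (m : ℕ) :
    Measurable fun ω => couponWait n m (fun i => X i ω) := by
  have h1 : ∀ t, MeasurableSet {ω | couponWait n m (fun i => X i ω) = t + 1} := by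
    intro t
    simp only [couponWait_eq_succ_iff]
    exact (measurableSet_card_drawn h (t + 1) (n - m ≤ ·)).inter
      (measurableSet_card_drawn h t (· < n - m))
  refine measurable_to_countable' fun t => ?_
  cases t with
  | succ t => exact h1 t
  | zero =>
    -- Because `sInf ∅ = 0`, the value 0 also collects the paths that never finish; it is handled as
    -- the complement of all positive values.
    have : (fun ω => couponWait n m (fun i => X i ω)) ⁻¹' {0}
        = (⋃ t, {ω | couponWait n m (fun i => X i ω) = t + 1})ᶜ := by
      ext ω
      simp only [Set.mem_preimage, Set.mem_singleton_iff, Set.mem_compl_iff, Set.mem_iUnion,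
        Set.mem_ofPred_eq, not_exists]
      constructor
      · intro h0 t; omega
      · intro h0
        by_contra hne
        exact h0 _ (Nat.succ_pred_eq_of_ne_zero hne).symm
    rw [this]
    exact (MeasurableSet.iUnion h1).compl

theorem measureReal_couponWait_eq [IsProbabilityMeasure P] (h : IsUniformSampling P n X) {m : ℕ}
    (hm : m < n) (t : ℕ) :
    P.real {ω | couponWait n m (fun i => X i ω) = t} = waitMass n (n - m) t := by
  have hn : 0 < n := by omega
  obtain ⟨N, hN⟩ : ∃ N, n - m = N + 1 := ⟨n - m - 1, by omega⟩
  have hs : ∀ t, P.real {ω | couponWait n m (fun i => X i ω) = t + 1}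
      = waitMass n (n - m) (t + 1) := by
    intro t
    rw [hN, ← measureReal_card_drawn_eq_waitMass h hn, ← measureReal_card_drawn_and_new h hn]
    congr 1
    ext ω
    simp only [Set.mem_ofPred_eq, couponWait_eq_succ_iff, card_drawn_succ, hN]
    split_ifs with hx <;> simp [hx] <;> omega
  cases t with
  | succ t => exact hs t
  | zero =>
    -- The mass at 0 is found by subtraction: both mass functions have total 1 and agree at all
    -- positive times. In particular never finishing is a null event.
    have hW := measurable_couponWait (X := X) h.measurable m
    have h1 := (hasSum_nat_add_iff' 1).2 (hasSum_measureReal_eq (P := P) hW)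
    have h2 := (hasSum_nat_add_iff' 1).2 (hasSum_waitMass_moments (n := n) (j := n - m)
      (by omega)).1
    simp only [hs] at h1
    have := h1.unique h2
    simp only [Finset.sum_range_one] at this
    linarith

theorem moments_couponWait [IsProbabilityMeasure P] (h : IsUniformSampling P n X) {m : ℕ}
    (hm : m < n) :
    MemLp (fun ω => (couponWait n m (fun i => X i ω) : ℝ)) 2 P ∧
    ∫ ω, (couponWait n m (fun i => X i ω) : ℝ) ∂P = ∑ i ∈ Finset.range (n - m), (n : ℝ) / (n - i) ∧
    variance (fun ω => (couponWait n m (fun i => X i ω) : ℝ)) P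
      = ∑ i ∈ Finset.range (n - m), ((i : ℝ) / (n - i) + ((i : ℝ) / (n - i)) ^ 2) := by
  have hW := measurable_couponWait (X := X) h.measurable m
  obtain ⟨_, h1, h2⟩ := hasSum_waitMass_moments (n := n) (j := n - m) (by omega)
  simp only [← measureReal_couponWait_eq h hm] at h1 h2
  obtain ⟨_, i1⟩ := integrable_comp_and_integral_comp hW (f := fun t => (t : ℝ))
    (fun t => by positivity) h1
  obtain ⟨j2, i2⟩ := integrable_comp_and_integral_comp hW (f := fun t => (t : ℝ) ^ 2)
    (fun t => by positivity) h2
  have hL : MemLp (fun ω => (couponWait n m (fun i => X i ω) : ℝ)) 2 P :=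
    (memLp_two_iff_integrable_sq
      (Measurable.of_discrete.comp hW : Measurable fun ω => ((couponWait n m fun i => X i ω : ℕ) : ℝ)).aestronglyMeasurable).2 j2
  refine ⟨hL, i1, ?_⟩
  rw [variance_eq_sub hL, i1]
  simp only [Pi.pow_apply, i2]
  ring

theorem sum_range_eq_sum_Icc_div {m : ℕ} (hm : m < n) (f : ℝ → ℝ) :
    ∑ i ∈ Finset.range (n - m), f ((i : ℝ) / (n - i))
      = ∑ k ∈ Finset.Icc (m + 1) n, f (((n : ℝ) - k) / k) := by
  refine Finset.sum_bij' (fun i _ => n - i) (fun k _ => n - k) ?_ ?_ ?_ ?_ ?_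
  · intro i hi; simp at hi ⊢; omega
  · intro k hk; simp at hk ⊢; omega
  · intro i hi; simp at hi ⊢; omega
  · intro k hk; simp at hk ⊢; omega
  · intro i hi
    have : i ≤ n := by simp at hi; omega
    rw [Nat.cast_sub this, sub_sub_cancel]

theorem waitVar_eq [IsProbabilityMeasure P] (h : IsUniformSampling P n X) {m : ℕ}
    (hm : m < n) : waitVar P m X = aCoef n m 1 + aCoef n m 2 := by
  rw [waitVar, (moments_couponWait h hm).2.2, sum_range_eq_sum_Icc_div hm (fun x => x + x ^ 2),
    Finset.sum_add_distrib, aCoef, aCoef]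
  simp only [pow_one]

/-- Subtracting 1 from each mean `n/(n-i)` leaves `i/(n-i)`, so the shifted mean is `a_{n,1}`, and
it cancels against the variance `a_{n,1} + a_{n,2}`. -/
theorem shiftConst_eq [IsProbabilityMeasure P] (h : IsUniformSampling P n X) {m : ℕ}
    (hm : m < n) : shiftConst P m X = ⌊aCoef n m 2⌋ := by
  obtain ⟨hL, h1, -⟩ := moments_couponWait h hm
  have hv := waitVar_eq h hm
  rw [waitVar] at hv
  have e : (fun ω => (shiftedWait n m (fun i => X i ω) : ℝ))
      = fun ω => (couponWait n m (fun i => X i ω) : ℝ) - ((n : ℝ) - m) := by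
    funext ω; simp [shiftedWait]
  have hi : ∫ ω, (shiftedWait n m (fun i => X i ω) : ℝ) ∂P = aCoef n m 1 := by
    rw [e, integral_sub (hL.integrable (by norm_num)) (integrable_const _), h1, aCoef,
      ← sum_range_eq_sum_Icc_div hm (fun x => x ^ 1)]
    have : (n : ℝ) - m = ∑ i ∈ Finset.range (n - m), (1 : ℝ) := by
      simp [Nat.cast_sub hm.le]
    simp only [integral_const, probReal_univ, smul_eq_mul, one_mul]
    rw [this, ← Finset.sum_sub_distrib]
    refine Finset.sum_congr rfl fun i hi => ?_
    have h2 : (i : ℝ) < n := by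
      have := Finset.mem_range.1 hi
      exact_mod_cast (by omega : i < n)
    have h3 : (n : ℝ) - i ≠ 0 := by linarith
    field_simp
    ring
  rw [shiftConst, hi, e, variance_sub_const hL.aestronglyMeasurable, hv]
  congr 1; ring

theorem measurable_shiftedWait (h : ∀ i, Measurable (X i)) (m : ℕ) :
    Measurable fun ω => shiftedWait n m (fun i => X i ω) := by
  have := measurable_couponWait h m
  unfold shiftedWait
  fun_prop

/-- The Fourier-Stieltjes transform of the law of the translated waiting time. -/
theorem hasSum_couponLaw [IsProbabilityMeasure P] (h : IsUniformSampling P n X) {m : ℕ}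
    (hm : m < n) (t : ℝ) :
    HasSum (fun k : ℤ => Complex.exp (Complex.I * t * k) * ((couponLaw P m X).real {k} : ℂ))
      ((1 + (Complex.exp (Complex.I * t) - 1)) ^ ⌊aCoef n m 2⌋ *
        ∏ k ∈ Finset.Icc (m + 1) n,
          (1 - (((n : ℝ) - k) / k : ℝ) * (Complex.exp (Complex.I * t) - 1))⁻¹) := by
  set z := Complex.exp (Complex.I * t) with hz
  have hz1 : ‖z‖ = 1 := by rw [hz, mul_comm, Complex.norm_exp_ofReal_mul_I]
  have hz0 : z ≠ 0 := Complex.exp_ne_zero _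
  set c := ⌊aCoef n m 2⌋
  have hs := (hasSum_waitMass_mul_pow (n := n) (j := n - m) (by omega) hz1).mul_left
    (z ^ (c - (n - m : ℕ) : ℤ))
  have hlaw : ∀ k : ℤ, (couponLaw P m X).real {k}
      = P.real {ω | (couponWait n m (fun i => X i ω) : ℤ) = k - c + (n - m : ℕ)} := by
    intro k
    rw [couponLaw, shiftConst_eq h hm, measureReal_def, Measure.map_apply
      ((measurable_shiftedWait h.measurable m).add_const _) (measurableSet_singleton k)]
    rw [measureReal_def]
    congr 2
    ext ω
    simp only [Set.mem_preimage, Set.mem_singleton_iff, Set.mem_ofPred_eq, shiftedWait]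
    push_cast [hm.le]
    omega
  have hinj : Function.Injective (fun j : ℕ => (j : ℤ) + c - (n - m : ℕ)) := by
    intro a b hab
    simp only at hab
    omega
  rw [← hinj.hasSum_iff]
  · convert! hs using 1
    · funext j
      have e : {ω | (couponWait n m (fun i => X i ω) : ℤ)
          = (j : ℤ) + c - (n - m : ℕ) - c + (n - m : ℕ)}
          = {ω | couponWait n m (fun i => X i ω) = j} := by
        ext ω
        simp only [Set.mem_ofPred_eq]
        omega
      have ez : ∀ k : ℤ, Complex.exp (Complex.I * t * k) = z ^ k := by
        intro k
        rw [hz, ← Complex.exp_int_mul, mul_comm]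
      simp only [Function.comp_apply]
      rw [hlaw, e, measureReal_couponWait_eq h hm, ez, ← mul_assoc, ← zpow_natCast z j,
        ← zpow_add₀ hz0]
      congr 2
      ring
    · rw [add_sub_cancel, ← mul_assoc, ← zpow_natCast z (n - m), ← zpow_add₀ hz0, sub_add_cancel]
      congr 1
      refine (Finset.prod_bij' (fun i _ => n - i) (fun k _ => n - k) ?_ ?_ ?_ ?_ ?_).symm
      · intro i hi; simp at hi ⊢; omega
      · intro k hk; simp at hk ⊢; omega
      · intro i hi; simp at hi ⊢; omega
      · intro k hk; simp at hk ⊢; omega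
      · intro i hi
        have : i ≤ n := by simp at hi; omega
        rw [Nat.cast_sub this, sub_sub_cancel]
  · intro k hk
    have hneg : k - c + (n - m : ℕ) < 0 := by
      by_contra hge
      exact hk ⟨(k - c + (n - m : ℕ)).toNat, by simp only; omega⟩
    have e : {ω | (couponWait n m (fun i => X i ω) : ℤ) = k - c + (n - m : ℕ)} = ∅ := by
      ext ω
      simp only [Set.mem_ofPred_eq, Set.mem_empty_iff_false, iff_false]
      omega
    rw [hlaw, e]
    simp

end Law

/-! ### Bounds for the coefficients of the expansion -/

section Coefficients

variable {n m : ℕ} {B : ℝ}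

theorem ratio_nonneg {k : ℕ} (hk : k ∈ Finset.Icc (m + 1) n) : 0 ≤ ((n : ℝ) - k) / k := by
  have : (k : ℝ) ≤ n := by exact_mod_cast (Finset.mem_Icc.1 hk).2
  exact div_nonneg (by linarith) (by positivity)

theorem aCoef_nonneg (n m r : ℕ) : 0 ≤ aCoef n m r :=
  Finset.sum_nonneg fun _ hk => pow_nonneg (ratio_nonneg hk) _

theorem aCoef_le (hx : ∀ k ∈ Finset.Icc (m + 1) n, ((n : ℝ) - k) / k ≤ B) {r : ℕ} (hr : 2 ≤ r) :
    aCoef n m r ≤ aCoef n m 2 * B ^ (r - 2) := by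
  rw [aCoef, aCoef, Finset.sum_mul]
  refine Finset.sum_le_sum fun k hk => ?_
  obtain ⟨q, rfl⟩ := Nat.exists_eq_add_of_le hr
  rw [pow_add, Nat.add_sub_cancel_left]
  have := ratio_nonneg hk
  gcongr
  exact hx k hk

theorem abs_coef_le (hB : 1 ≤ B) (hx : ∀ k ∈ Finset.Icc (m + 1) n, ((n : ℝ) - k) / k ≤ B)
    {r : ℕ} (hr : 2 ≤ r) :
    |aCoef n m r + (-1) ^ (r + 1) * (⌊aCoef n m 2⌋ : ℝ)| ≤ 2 * (aCoef n m 2 * B ^ (r - 2)) := by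
  have h2 := aCoef_nonneg n m 2
  have hf : (0 : ℝ) ≤ ⌊aCoef n m 2⌋ := by exact_mod_cast Int.floor_nonneg.2 h2
  refine (abs_add_le _ _).trans ?_
  rw [abs_mul, abs_pow, abs_neg, abs_one, one_pow, one_mul, abs_of_nonneg (aCoef_nonneg n m r),
    abs_of_nonneg hf, two_mul]
  refine add_le_add (aCoef_le hx hr) ?_
  exact (Int.floor_le _).trans (le_mul_of_one_le_right h2 (one_le_pow₀ hB))

theorem eval_hPoly (n m R : ℕ) (w : ℂ) : ((hPoly n m R).map (algebraMap ℝ ℂ)).eval w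
    = -((aCoef n m 2 - ⌊aCoef n m 2⌋ : ℝ) : ℂ) * w
      + ((aCoef n m 2 - ⌊aCoef n m 2⌋ : ℝ) : ℂ) / 2 * w ^ 2
      + ∑ r ∈ Finset.Icc 3 R,
        ((aCoef n m r + (-1) ^ (r + 1) * (⌊aCoef n m 2⌋ : ℝ) : ℝ) : ℂ) / r * w ^ r := by
  simp [hPoly, Polynomial.eval_finsetSum, Polynomial.map_sum]

theorem eval_HPoly (n m R : ℕ) (w : ℂ) : ((HPoly n m R).map (algebraMap ℝ ℂ)).eval w
    = ∑ l ∈ Finset.range (R + 1),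
        ((hPoly n m R).map (algebraMap ℝ ℂ)).eval w ^ l / (l.factorial : ℂ) := by
  simp only [HPoly, Polynomial.map_sum, Polynomial.eval_finsetSum, Polynomial.map_mul,
    Polynomial.map_pow, Polynomial.eval_mul, Polynomial.eval_pow, Polynomial.map_C,
    Polynomial.eval_C]
  refine Finset.sum_congr rfl fun l _ => ?_
  simp
  ring

/-- The coefficients in degrees 1 and 2 are bounded absolutely because they involve only the
fractional part of `a_{n,2}`. The factor `2/3` is `2/r` at the worst case `r = 3`. -/
theorem norm_eval_hPoly_le (hB : 1 ≤ B)
    (hx : ∀ k ∈ Finset.Icc (m + 1) n, ((n : ℝ) - k) / k ≤ B) (R : ℕ) (w : ℂ) :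
    ‖((hPoly n m R).map (algebraMap ℝ ℂ)).eval w‖ ≤ ‖w‖ + ‖w‖ ^ 2 / 2
      + ∑ r ∈ Finset.Icc 3 R, 2 / 3 * (aCoef n m 2 * B ^ (r - 2)) * ‖w‖ ^ r := by
  have h0 : 0 ≤ aCoef n m 2 - ⌊aCoef n m 2⌋ := by linarith [Int.floor_le (aCoef n m 2)]
  have h1 : aCoef n m 2 - ⌊aCoef n m 2⌋ ≤ 1 := by linarith [Int.lt_floor_add_one (aCoef n m 2)]
  have h2 := aCoef_nonneg n m 2
  rw [eval_hPoly]
  refine (norm_add_le _ _).trans (add_le_add ((norm_add_le _ _).trans (add_le_add ?_ ?_)) ?_)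
  · rw [norm_mul, norm_neg, Complex.norm_real, Real.norm_of_nonneg h0]
    exact mul_le_of_le_one_left (norm_nonneg _) h1
  · rw [norm_mul, norm_div, norm_pow, Complex.norm_real, Real.norm_of_nonneg h0,
      Complex.norm_ofNat, div_mul_eq_mul_div]
    gcongr
    exact mul_le_of_le_one_left (by positivity) h1
  · refine (norm_sum_le _ _).trans (Finset.sum_le_sum fun r hr => ?_)
    have hr3 : 3 ≤ r := (Finset.mem_Icc.1 hr).1
    have hr3' : (3 : ℝ) ≤ r := by exact_mod_cast hr3
    rw [norm_mul, norm_div, norm_pow, Complex.norm_real, Real.norm_eq_abs, Complex.norm_natCast]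
    gcongr
    rw [div_le_iff₀ (by linarith)]
    have := abs_coef_le hB hx (r := r) (by omega)
    have hp : 0 ≤ aCoef n m 2 * B ^ (r - 2) := by positivity
    nlinarith

/-- For `B|w| ≤ 1/16` the terms of degree at least 3 are dominated by a geometric series led by the
cubic one; its sum, at most `3/2`, cancels the `2/3`. -/
theorem norm_eval_hPoly_le_of_small (hB : 1 ≤ B)
    (hx : ∀ k ∈ Finset.Icc (m + 1) n, ((n : ℝ) - k) / k ≤ B) (R : ℕ) {w : ℂ}
    (hw : B * ‖w‖ ≤ 1 / 16) :
    ‖((hPoly n m R).map (algebraMap ℝ ℂ)).eval w‖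
      ≤ 2 * ‖w‖ + aCoef n m 2 * B * ‖w‖ ^ 3 := by
  have h2 := aCoef_nonneg n m 2
  have hv : 0 ≤ ‖w‖ := norm_nonneg w
  set v := ‖w‖
  have hv1 : v ≤ 1 := by nlinarith
  have hgeom : ∑ r ∈ Finset.Icc 3 R, (1 / 16 : ℝ) ^ (r - 3) ≤ 3 / 2 := by
    have e : Finset.Icc 3 R = Finset.Ico 3 (R + 1) := by ext; simp
    rw [e, Finset.sum_Ico_eq_sum_range]
    simp only [Nat.add_sub_cancel_left]
    have := (summable_geometric_of_lt_one (r := (1 / 16 : ℝ)) (by norm_num)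
      (by norm_num)).sum_le_tsum (Finset.range (R + 1 - 3)) fun _ _ => by positivity
    rw [tsum_geometric_of_lt_one (by norm_num) (by norm_num)] at this
    exact this.trans (by norm_num)
  have hsum : ∑ r ∈ Finset.Icc 3 R, 2 / 3 * (aCoef n m 2 * B ^ (r - 2)) * v ^ r
      ≤ ∑ r ∈ Finset.Icc 3 R, (2 / 3 * (aCoef n m 2 * B * v ^ 3)) * (1 / 16 : ℝ) ^ (r - 3) := by
    refine Finset.sum_le_sum fun r hr => ?_
    obtain ⟨q, rfl⟩ := Nat.exists_eq_add_of_le (Finset.mem_Icc.1 hr).1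
    have e1 : 3 + q - 2 = 1 + q := by omega
    rw [e1, Nat.add_sub_cancel_left]
    calc 2 / 3 * (aCoef n m 2 * B ^ (1 + q)) * v ^ (3 + q)
        = (2 / 3 * (aCoef n m 2 * B * v ^ 3)) * (B * v) ^ q := by ring
      _ ≤ _ := by gcongr
  rw [← Finset.mul_sum] at hsum
  have h3 : (2 / 3 * (aCoef n m 2 * B * v ^ 3)) * ∑ r ∈ Finset.Icc 3 R, (1 / 16 : ℝ) ^ (r - 3)
      ≤ (2 / 3 * (aCoef n m 2 * B * v ^ 3)) * (3 / 2) := by gcongr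
  have := norm_eval_hPoly_le hB hx R w
  nlinarith

/-- Away from zero everything is measured in `y = B|w|`: since `a_{n,2} ≤ S B²`, the term of degree
`r` is at most `S y^r`. -/
theorem norm_eval_hPoly_le_of_le_two (hB : 1 ≤ B)
    (hx : ∀ k ∈ Finset.Icc (m + 1) n, ((n : ℝ) - k) / k ≤ B) {R : ℕ} (hR : 3 ≤ R) {w : ℂ}
    (hw : ‖w‖ ≤ 2) {S : ℝ} (hS : 1 ≤ S) (haS : aCoef n m 2 ≤ S * B ^ 2) :
    ‖((hPoly n m R).map (algebraMap ℝ ℂ)).eval w‖ ≤ (1 + R) * S * (1 + B * ‖w‖) ^ R := by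
  have h2 := aCoef_nonneg n m 2
  have hv : 0 ≤ ‖w‖ := norm_nonneg w
  set v := ‖w‖
  have hy : v ≤ B * v := le_mul_of_one_le_left hv hB
  have hB0 : 0 ≤ B := by linarith
  have hy0 : 0 ≤ B * v := by positivity
  have hsum : ∑ r ∈ Finset.Icc 3 R, 2 / 3 * (aCoef n m 2 * B ^ (r - 2)) * v ^ r
      ≤ ∑ r ∈ Finset.Icc 3 R, S * (1 + B * v) ^ R := by
    refine Finset.sum_le_sum fun r hr => ?_
    obtain ⟨hr1, hr2⟩ := Finset.mem_Icc.1 hr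
    obtain ⟨q, rfl⟩ := Nat.exists_eq_add_of_le (show 2 ≤ r by omega)
    rw [Nat.add_sub_cancel_left]
    calc 2 / 3 * (aCoef n m 2 * B ^ q) * v ^ (2 + q)
        ≤ 1 * (S * B ^ 2 * B ^ q) * v ^ (2 + q) := by gcongr; norm_num
      _ = S * (B * v) ^ (2 + q) := by ring
      _ ≤ S * (1 + B * v) ^ (2 + q) := by gcongr; linarith
      _ ≤ S * (1 + B * v) ^ R := by gcongr; linarith
  have hcard : ((Finset.Icc 3 R).card : ℝ) ≤ R := by
    exact_mod_cast (by simp : (Finset.Icc 3 R).card ≤ R)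
  rw [Finset.sum_const, nsmul_eq_mul] at hsum
  have h3 : ((Finset.Icc 3 R).card : ℝ) * (S * (1 + B * v) ^ R) ≤ R * (S * (1 + B * v) ^ R) := by
    gcongr
  have h4 : v + v ^ 2 / 2 ≤ S * (1 + B * v) ^ R := by
    calc v + v ^ 2 / 2 ≤ 1 * (1 + B * v) ^ 2 := by nlinarith
      _ ≤ S * (1 + B * v) ^ R := by gcongr; linarith; omega
  have := norm_eval_hPoly_le hB hx R w
  nlinarith

end Coefficients

/-! ### Logarithmic expansion of the transform -/

theorem sum_range_succ_eq_add_sum_Icc {M : Type*} [AddCommMonoid M] (f : ℕ → M) {R : ℕ}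
    (hR : 2 ≤ R) :
    ∑ r ∈ Finset.range (R + 1), f r = f 0 + f 1 + f 2 + ∑ r ∈ Finset.Icc 3 R, f r := by
  induction R, hR using Nat.le_induction with
  | base => simp [Finset.sum_range_succ]
  | succ R hR ih =>
    rw [Finset.sum_range_succ, ih, Finset.sum_Icc_succ_top (by omega)]
    abel

/-- The logarithm of the transform, for arguments `w = exp (i t) - 1` near zero. -/
theorem exists_log_expansion {n m : ℕ} {B : ℝ} (hB : 1 ≤ B)
    (hx : ∀ k ∈ Finset.Icc (m + 1) n, ((n : ℝ) - k) / k ≤ B) {R : ℕ} (hR : 3 ≤ R) {w : ℂ}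
    (hw : B * ‖w‖ ≤ 1 / 16) :
    ∃ E : ℂ, ‖E‖ ≤ aCoef n m 2 * B ^ (R - 1) * ‖w‖ ^ (R + 1) ∧
      (1 + w) ^ ⌊aCoef n m 2⌋ *
        ∏ k ∈ Finset.Icc (m + 1) n, (1 - (((n : ℝ) - k) / k : ℝ) * w)⁻¹
      = Complex.exp (((aCoef n m 1 + aCoef n m 2 : ℝ) : ℂ) * w
        + ((hPoly n m R).map (algebraMap ℝ ℂ)).eval w + E) := by
  have h2 := aCoef_nonneg n m 2
  have hf : (0 : ℝ) ≤ ⌊aCoef n m 2⌋ := by exact_mod_cast Int.floor_nonneg.2 h2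
  have hv : 0 ≤ ‖w‖ := norm_nonneg w
  have hv1 : ‖w‖ ≤ 1 / 16 := by nlinarith
  set c := ⌊aCoef n m 2⌋ with hc
  let x : ℕ → ℝ := fun k => ((n : ℝ) - k) / k
  have hx0 : ∀ k ∈ Finset.Icc (m + 1) n, 0 ≤ x k := fun k hk => ratio_nonneg hk
  have hxn : ∀ k ∈ Finset.Icc (m + 1) n, ‖-(x k * w : ℂ)‖ = x k * ‖w‖ := fun k hk => by
    rw [norm_neg, norm_mul, Complex.norm_real, Real.norm_of_nonneg (hx0 k hk)]
  have hxs : ∀ k ∈ Finset.Icc (m + 1) n, ‖-(x k * w : ℂ)‖ ≤ 1 / 16 := fun k hk => by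
    rw [hxn k hk]
    exact (mul_le_mul_of_nonneg_right (hx k hk) hv).trans hw
  have hlog : ∀ z : ℂ, ‖z‖ ≤ 1 / 16 →
      ‖Complex.log (1 + z) - Complex.logTaylor (R + 1) z‖ ≤ 1 / 2 * ‖z‖ ^ (R + 1) := by
    intro z hz
    refine (Complex.norm_log_sub_logTaylor_le R (by linarith)).trans ?_
    have h1 : (1 - ‖z‖)⁻¹ ≤ 2 := by
      rw [inv_le_comm₀ (by linarith) (by norm_num)]; linarith
    have hR' : (4 : ℝ) ≤ R + 1 := by exact_mod_cast (by omega : 4 ≤ R + 1)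
    rw [div_le_iff₀ (by linarith)]
    have hp : 0 ≤ ‖z‖ ^ (R + 1) := by positivity
    calc ‖z‖ ^ (R + 1) * (1 - ‖z‖)⁻¹ ≤ ‖z‖ ^ (R + 1) * 2 := by gcongr
      _ ≤ 1 / 2 * ‖z‖ ^ (R + 1) * (R + 1) := by nlinarith
  have hne : ∀ z : ℂ, ‖z‖ ≤ 1 / 16 → 1 + z ≠ 0 := by
    intro z hz h0
    have : z = -1 := by linear_combination h0
    rw [this, norm_neg, norm_one] at hz
    norm_num at hz
  refine ⟨c * (Complex.log (1 + w) - Complex.logTaylor (R + 1) w)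
    - ∑ k ∈ Finset.Icc (m + 1) n, (Complex.log (1 + -(x k * w))
      - Complex.logTaylor (R + 1) (-(x k * w))), ?_, ?_⟩
  · refine (norm_sub_le _ _).trans ?_
    have e1 : ‖(c : ℂ) * (Complex.log (1 + w) - Complex.logTaylor (R + 1) w)‖
        ≤ aCoef n m 2 * B ^ (R - 1) * (1 / 2 * ‖w‖ ^ (R + 1)) := by
      rw [norm_mul]
      have : ‖(c : ℂ)‖ ≤ aCoef n m 2 * B ^ (R - 1) := by
        have e : (c : ℂ) = ((c : ℝ) : ℂ) := by simp
        rw [e, Complex.norm_real, Real.norm_of_nonneg hf]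
        exact (Int.floor_le _).trans (le_mul_of_one_le_right h2 (one_le_pow₀ hB))
      gcongr
      exact hlog w hv1
    have e2 : ‖∑ k ∈ Finset.Icc (m + 1) n, (Complex.log (1 + -(x k * w))
        - Complex.logTaylor (R + 1) (-(x k * w)))‖
        ≤ aCoef n m 2 * B ^ (R - 1) * (1 / 2 * ‖w‖ ^ (R + 1)) := by
      have := aCoef_le hx (r := R + 1) (by omega)
      rw [show R + 1 - 2 = R - 1 by omega] at this
      calc _ ≤ ∑ k ∈ Finset.Icc (m + 1) n, x k ^ (R + 1) * (1 / 2 * ‖w‖ ^ (R + 1)) := by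
            refine (norm_sum_le _ _).trans (Finset.sum_le_sum fun k hk => ?_)
            refine (hlog _ (hxs k hk)).trans ?_
            rw [hxn k hk, mul_pow]
            exact le_of_eq (by ring)
        _ = aCoef n m (R + 1) * (1 / 2 * ‖w‖ ^ (R + 1)) := by rw [← Finset.sum_mul]; rfl
        _ ≤ _ := by gcongr
    linarith
  · have hmain : ((aCoef n m 1 + aCoef n m 2 : ℝ) : ℂ) * w
        + ((hPoly n m R).map (algebraMap ℝ ℂ)).eval w
        = c * Complex.logTaylor (R + 1) w
          - ∑ k ∈ Finset.Icc (m + 1) n, Complex.logTaylor (R + 1) (-(x k * w)) := by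
      have ht : c * Complex.logTaylor (R + 1) w
          - ∑ k ∈ Finset.Icc (m + 1) n, Complex.logTaylor (R + 1) (-(x k * w))
          = ∑ r ∈ Finset.range (R + 1),
            ((aCoef n m r + (-1) ^ (r + 1) * (c : ℝ) : ℝ) : ℂ) / r * w ^ r := by
        simp only [Complex.logTaylor]
        rw [Finset.sum_comm, Finset.mul_sum, ← Finset.sum_sub_distrib]
        refine Finset.sum_congr rfl fun r _ => ?_
        have : (aCoef n m r : ℂ) = ∑ k ∈ Finset.Icc (m + 1) n, (x k : ℂ) ^ r := by
          simp [aCoef, x]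
        push_cast
        rw [this, add_div, add_mul, Finset.sum_div, Finset.sum_mul, sub_eq_add_neg,
          ← Finset.sum_neg_distrib, add_comm]
        congr 1
        · refine Finset.sum_congr rfl fun k _ => ?_
          have : (-1 : ℂ) ^ (r + 1) * (-(x k * w)) ^ r = -((x k : ℂ) ^ r * w ^ r) := by
            rw [neg_pow (x k * w : ℂ), pow_succ, mul_pow]
            have : (-1 : ℂ) ^ r * (-1) ^ r = 1 := by rw [← mul_pow]; simp
            linear_combination (-(x k : ℂ) ^ r * w ^ r) * this
          rw [this]; ring
        · ring
      -- The term `r = 0` vanishes because division by zero gives 0. The linear coefficient `a_{n,1}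
      -- + c` splits as `σ²` minus the fractional part of `a_{n,2}`.
      rw [ht, sum_range_succ_eq_add_sum_Icc _ (by omega), eval_hPoly]
      push_cast
      ring
    rw [hmain]
    have e : ∀ a b b' d d' : ℂ, a * b - d + (a * (b' - b) - (d' - d)) = a * b' - d' := by
      intros; ring
    -- Only exponentials of the separate logarithms are multiplied, so no choice of branch for their
    -- sum is involved.
    rw [Finset.sum_sub_distrib, e, Complex.exp_sub, Complex.exp_int_mul,
      Complex.exp_log (hne w hv1), Complex.exp_sum, div_eq_mul_inv, Finset.prod_inv_distrib]
    congr 2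
    refine Finset.prod_congr rfl fun k hk => ?_
    rw [Complex.exp_log (hne _ (hxs k hk)), sub_eq_add_neg]

/-! ### Comparison of the transforms -/

/-- The difference of the transforms for arguments near zero. -/
theorem exists_norm_transform_sub_le_of_small {R : ℕ} (hR : 3 ≤ R) :
    ∃ K : ℝ, 0 < K ∧ ∀ (n m : ℕ) (B s : ℝ), 1 ≤ B →
      (∀ k ∈ Finset.Icc (m + 1) n, ((n : ℝ) - k) / k ≤ B) →
      s = aCoef n m 1 + aCoef n m 2 → 0 < s → ∀ w : ℂ, ‖1 + w‖ = 1 → B * ‖w‖ ≤ 1 / 16 →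
      ‖(1 + w) ^ ⌊aCoef n m 2⌋ *
          ∏ k ∈ Finset.Icc (m + 1) n, (1 - (((n : ℝ) - k) / k : ℝ) * w)⁻¹
        - Complex.exp (s * w) * ((HPoly n m R).map (algebraMap ℝ ℂ)).eval w‖
      ≤ K * ((1 / √s) ^ (R + 1) * (aCoef n m 2 * B ^ (R - 1) + B ^ (R + 1)))
          * Real.exp (-(s * ‖w‖ ^ 2 / 4)) := by
  obtain ⟨K, hK, hKb⟩ := exists_one_add_pow_mul_exp_neg_le (2 * (R + 1)) (κ := 1 / 8) (by norm_num)
  refine ⟨Real.exp 1 * 2 ^ (R + 1) * K, by positivity, ?_⟩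
  intro n m B s hB hx hs hs0 w hw hwB
  have h2 := aCoef_nonneg n m 2
  have h2s : aCoef n m 2 ≤ s := by linarith [aCoef_nonneg n m 1]
  obtain ⟨E, hE, hexp⟩ := exists_log_expansion hB hx hR hwB
  have hh := norm_eval_hPoly_le_of_small hB hx R hwB
  rw [hexp, eval_HPoly, ← hs]
  set h := ((hPoly n m R).map (algebraMap ℝ ℂ)).eval w
  set H := ∑ l ∈ Finset.range (R + 1), h ^ l / (l.factorial : ℂ) with hH
  set a := aCoef n m 2
  have hv : 0 ≤ ‖w‖ := norm_nonneg w
  set v := ‖w‖ with hvdef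
  have hvB : v ≤ B * v := le_mul_of_one_le_left hv hB
  have hB0 : 0 ≤ B := by linarith
  -- The cost of exponentiating `h` and `E` stays well below the Gaussian gain `s v²/2`.
  have hsum : ‖h‖ + ‖E‖ ≤ 1 + s * v ^ 2 / 8 := by
    have h1 : a * B * v ^ 3 ≤ s * v ^ 2 / 16 := by
      calc a * B * v ^ 3 = a * v ^ 2 * (B * v) := by ring
        _ ≤ s * v ^ 2 * (1 / 16) := by gcongr
        _ = _ := by ring
    have h3 : a * B ^ (R - 1) * v ^ (R + 1) ≤ s * v ^ 2 / 16 := by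
      obtain ⟨q, rfl⟩ := Nat.exists_eq_add_of_le hR
      rw [show 3 + q - 1 = q + 2 by omega]
      calc a * B ^ (q + 2) * v ^ (3 + q + 1) = a * v ^ 2 * (B * v) ^ (q + 2) := by ring
        _ ≤ s * v ^ 2 * (1 / 16) ^ (q + 2) := by gcongr
        _ ≤ s * v ^ 2 * (1 / 16) ^ 1 := by
          gcongr s * v ^ 2 * ?_
          exact pow_le_pow_of_le_one (by norm_num) (by norm_num) (by omega)
        _ = _ := by ring
    linarith
  -- Two separate errors: dropping `E`, and truncating the exponential series of `h` after degree
  -- `R`.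
  have hdiff : ‖Complex.exp (h + E) - H‖
      ≤ (‖E‖ + ‖h‖ ^ (R + 1)) * Real.exp (‖h‖ + ‖E‖) := by
    have e1 : ‖Complex.exp E - 1‖ ≤ ‖E‖ * Real.exp ‖E‖ := by
      simpa using Complex.norm_exp_sub_sum_le_norm_mul_exp E 1
    have e2 := Complex.norm_exp_sub_sum_le_norm_mul_exp h (R + 1)
    rw [← hH] at e2
    have e3 : ‖Complex.exp h‖ ≤ Real.exp ‖h‖ := Complex.norm_exp_le_exp_norm h
    have e4 : Complex.exp (h + E) - H
        = Complex.exp h * (Complex.exp E - 1) + (Complex.exp h - H) := by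
      rw [Complex.exp_add]; ring
    rw [e4]
    calc _ ≤ ‖Complex.exp h‖ * ‖Complex.exp E - 1‖ + ‖Complex.exp h - H‖ := by
          rw [← norm_mul]; exact norm_add_le _ _
      _ ≤ Real.exp ‖h‖ * (‖E‖ * Real.exp ‖E‖) + ‖h‖ ^ (R + 1) * (Real.exp ‖h‖ * Real.exp ‖E‖) := by
          gcongr
          exact e2.trans (by
            gcongr
            exact le_mul_of_one_le_right (Real.exp_pos _).le (Real.one_le_exp (norm_nonneg _)))
      _ = _ := by rw [Real.exp_add]; ring
  have hsq : 0 < √s := Real.sqrt_pos.2 hs0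
  have hss : √s ^ 2 = s := Real.sq_sqrt hs0.le
  set y := √s * v with hy
  have hy0 : 0 ≤ y := by positivity
  have hy2 : y ^ 2 = s * v ^ 2 := by rw [hy, mul_pow, hss]
  have hvy : v ^ (R + 1) = (1 / √s) ^ (R + 1) * y ^ (R + 1) := by
    rw [← mul_pow]; congr 1; rw [hy]; field_simp
  have hy1 : y ≤ 1 + y ^ 2 := by nlinarith
  have hhp : ‖h‖ ^ (R + 1) ≤ 2 ^ (R + 1) * B ^ (R + 1) * v ^ (R + 1) * (1 + y ^ 2) ^ (R + 1) := by
    have : ‖h‖ ≤ 2 * B * v * (1 + y ^ 2) := by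
      rw [hy2]
      have h1 : a * B * v ^ 3 ≤ B * v * (s * v ^ 2) := by
        calc a * B * v ^ 3 = B * v * (a * v ^ 2) := by ring
          _ ≤ _ := by gcongr
      have h3 : 0 ≤ B * v * (s * v ^ 2) := by positivity
      linarith
    calc ‖h‖ ^ (R + 1) ≤ (2 * B * v * (1 + y ^ 2)) ^ (R + 1) := by gcongr
      _ = _ := by rw [mul_pow, mul_pow, mul_pow]
  have hEp : ‖E‖ ≤ 2 ^ (R + 1) * (a * B ^ (R - 1)) * v ^ (R + 1) * (1 + y ^ 2) ^ (R + 1) := by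
    have h1 : (1 : ℝ) ≤ 2 ^ (R + 1) := one_le_pow₀ (by norm_num)
    have h3 : (1 : ℝ) ≤ (1 + y ^ 2) ^ (R + 1) := one_le_pow₀ (by nlinarith)
    calc ‖E‖ ≤ 1 * (a * B ^ (R - 1)) * v ^ (R + 1) * 1 := by linarith
      _ ≤ _ := by gcongr
  have hcomb : ‖E‖ + ‖h‖ ^ (R + 1) ≤ 2 ^ (R + 1)
      * ((1 / √s) ^ (R + 1) * (a * B ^ (R - 1) + B ^ (R + 1))) * (1 + y ^ 2) ^ (2 * (R + 1)) := by
    calc ‖E‖ + ‖h‖ ^ (R + 1) ≤ 2 ^ (R + 1) * (a * B ^ (R - 1) + B ^ (R + 1)) * v ^ (R + 1)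
          * (1 + y ^ 2) ^ (R + 1) := by linarith
      _ = 2 ^ (R + 1) * ((1 / √s) ^ (R + 1) * (a * B ^ (R - 1) + B ^ (R + 1)))
          * (y ^ (R + 1) * (1 + y ^ 2) ^ (R + 1)) := by rw [hvy]; ring
      _ ≤ 2 ^ (R + 1) * ((1 / √s) ^ (R + 1) * (a * B ^ (R - 1) + B ^ (R + 1)))
          * ((1 + y ^ 2) ^ (R + 1) * (1 + y ^ 2) ^ (R + 1)) := by gcongr
      _ = _ := by ring
  have hfin := hKb (y ^ 2) (by positivity)
  set T := (1 / √s) ^ (R + 1) * (a * B ^ (R - 1) + B ^ (R + 1))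
  have hT : 0 ≤ T := by positivity
  have e5 : Complex.exp (s * w + h + E) - Complex.exp (s * w) * H
      = Complex.exp (s * w) * (Complex.exp (h + E) - H) := by
    rw [add_assoc, Complex.exp_add]; ring
  rw [e5, norm_mul, norm_exp_ofReal_mul hw, ← hvdef, ← hy2]
  rw [← hy2] at hsum
  calc Real.exp (-(y ^ 2 / 2)) * ‖Complex.exp (h + E) - H‖
      ≤ Real.exp (-(y ^ 2 / 2)) * ((2 ^ (R + 1) * T * (1 + y ^ 2) ^ (2 * (R + 1)))
          * Real.exp (1 + y ^ 2 / 8)) := by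
        gcongr
        refine hdiff.trans ?_
        gcongr
    _ = Real.exp 1 * 2 ^ (R + 1) * T * ((1 + y ^ 2) ^ (2 * (R + 1)) * Real.exp (-(1 / 8 * y ^ 2)))
          * Real.exp (-(y ^ 2 / 4)) := by
        -- The exponent `1/2` is spent as `1/8 + 1/8 + 1/4`: growth of `exp(‖h‖ + ‖E‖)`, absorption
        -- of the powers of `1 + y²`, and what is left to integrate.
        have : Real.exp (-(y ^ 2 / 2)) * Real.exp (1 + y ^ 2 / 8)
            = Real.exp 1 * Real.exp (-(1 / 8 * y ^ 2)) * Real.exp (-(y ^ 2 / 4)) := by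
          rw [← Real.exp_add, ← Real.exp_add, ← Real.exp_add]; congr 1; ring
        linear_combination (2 ^ (R + 1) * T * (1 + y ^ 2) ^ (2 * (R + 1))) * this
    _ ≤ Real.exp 1 * 2 ^ (R + 1) * T * K * Real.exp (-(y ^ 2 / 4)) := by gcongr
    _ = _ := by ring

/-- The transform of the law of the waiting time is small away from zero. -/
theorem norm_prod_inv_le {n m : ℕ} {B s : ℝ} (hB : 1 ≤ B)
    (hx : ∀ k ∈ Finset.Icc (m + 1) n, ((n : ℝ) - k) / k ≤ B)
    (hs : s = aCoef n m 1 + aCoef n m 2) {w : ℂ} (hw : ‖1 + w‖ = 1) (hwB : 1 / 16 ≤ B * ‖w‖) :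
    ‖(1 + w) ^ ⌊aCoef n m 2⌋ *
        ∏ k ∈ Finset.Icc (m + 1) n, (1 - (((n : ℝ) - k) / k : ℝ) * w)⁻¹‖
      ≤ Real.exp (-(s / B ^ 2 / 1024)) := by
  rw [norm_mul, norm_zpow, hw, one_zpow, one_mul, norm_prod]
  have hexp : -(s / B ^ 2 / 1024) = ∑ k ∈ Finset.Icc (m + 1) n,
      -((((n : ℝ) - k) / k + (((n : ℝ) - k) / k) ^ 2) * (1 / (256 * B ^ 2)) / 4) := by
    rw [Finset.sum_neg_distrib, ← Finset.sum_div, ← Finset.sum_mul, Finset.sum_add_distrib, hs]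
    simp only [aCoef, pow_one]
    ring
  rw [hexp, Real.exp_sum]
  refine Finset.prod_le_prod (fun _ _ => norm_nonneg _) fun k hk => ?_
  have hx0 := ratio_nonneg hk
  have hxB := hx k hk
  set x := ((n : ℝ) - k) / k
  have hB0 : 0 < B := by linarith
  -- Only this much of `‖w‖²` is used in each factor, which keeps `z ≤ 1`, so that `1 + z ≥
  -- exp(z/2)` applies. A square root then gives `exp(z/4)`, and `4 · 256 = 1024`.
  have hv : 1 / (256 * B ^ 2) ≤ ‖w‖ ^ 2 := by
    rw [div_le_iff₀ (by positivity)]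
    nlinarith
  set z := (x + x ^ 2) * (1 / (256 * B ^ 2)) with hz
  have hz0 : 0 ≤ z := by positivity
  have hz1 : z ≤ 1 := by
    rw [hz, mul_one_div, div_le_one (by positivity)]
    nlinarith
  have h1 : Real.exp (z / 4) ^ 2 ≤ ‖1 - x * w‖ ^ 2 := by
    rw [norm_one_sub_mul_sq hw, ← Real.exp_nat_mul]
    calc Real.exp ((2 : ℕ) * (z / 4)) = Real.exp (z / 2) := by congr 1; push_cast; ring
      _ ≤ 1 + z := exp_half_le_one_add hz0 hz1
      _ ≤ 1 + (x + x ^ 2) * ‖w‖ ^ 2 := by rw [hz]; gcongr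
  have h2 := (sq_le_sq₀ (Real.exp_pos _).le (norm_nonneg _)).1 h1
  rw [norm_inv, Real.exp_neg]
  exact inv_anti₀ (Real.exp_pos _) h2

/-- The transform of the approximating signed measure is small away from zero. -/
theorem exists_norm_exp_mul_HPoly_le {R : ℕ} (hR : 3 ≤ R) :
    ∃ K : ℝ, 0 < K ∧ ∀ (n m : ℕ) (B s : ℝ), 1 ≤ B →
      (∀ k ∈ Finset.Icc (m + 1) n, ((n : ℝ) - k) / k ≤ B) →
      s = aCoef n m 1 + aCoef n m 2 → 1 ≤ s / B ^ 2 → ∀ w : ℂ, ‖1 + w‖ = 1 → 1 / 16 ≤ B * ‖w‖ →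
      ‖Complex.exp (s * w) * ((HPoly n m R).map (algebraMap ℝ ℂ)).eval w‖
      ≤ K * Real.exp (-(s / B ^ 2 / 1024)) := by
  obtain ⟨K₁, hK₁, hKb₁⟩ := exists_one_add_pow_mul_exp_neg_le R (κ := 1 / 2048) (by norm_num)
  obtain ⟨K₂, hK₂, hKb₂⟩ := exists_one_add_pow_mul_exp_neg_le (R * R) (κ := 1 / 8) (by norm_num)
  refine ⟨(R + 1) * ((1 + R) ^ R * 2 ^ (R * R)) * K₁ * K₂, by positivity, ?_⟩
  intro n m B s hB hx hs hS w hw hwB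
  have hB0 : 0 < B := by linarith
  have h2s : aCoef n m 2 ≤ s := by linarith [aCoef_nonneg n m 1]
  set S := s / B ^ 2 with hSdef
  have hsS : s = S * B ^ 2 := by rw [hSdef]; field_simp
  have hw2 : ‖w‖ ≤ 2 := by
    calc ‖w‖ = ‖(1 + w) - 1‖ := by rw [add_sub_cancel_left]
      _ ≤ ‖1 + w‖ + ‖(1 : ℂ)‖ := norm_sub_le _ _
      _ = 2 := by rw [hw, norm_one]; norm_num
  have hh := norm_eval_hPoly_le_of_le_two hB hx hR hw2 hS (hsS ▸ h2s)
  rw [eval_HPoly, norm_mul, norm_exp_ofReal_mul hw]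
  set h := ((hPoly n m R).map (algebraMap ℝ ℂ)).eval w
  have hv : 0 ≤ ‖w‖ := norm_nonneg w
  set v := ‖w‖
  set y := B * v with hy
  have hy0 : 0 ≤ y := by positivity
  set M := (1 + R) * S * (1 + y) ^ R with hM
  have hM1 : 1 ≤ M := by
    have h1 : (1 : ℝ) ≤ 1 + R := by linarith [(Nat.cast_nonneg R : (0 : ℝ) ≤ R)]
    have h3 : (1 : ℝ) ≤ (1 + y) ^ R := one_le_pow₀ (by linarith)
    exact one_le_mul_of_one_le_of_one_le (one_le_mul_of_one_le_of_one_le h1 hS) h3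
  have hH : ‖∑ l ∈ Finset.range (R + 1), h ^ l / (l.factorial : ℂ)‖ ≤ (R + 1) * M ^ R := by
    calc _ ≤ ∑ l ∈ Finset.range (R + 1), M ^ R := by
          refine (norm_sum_le _ _).trans (Finset.sum_le_sum fun l hl => ?_)
          rw [norm_div, norm_pow, Complex.norm_natCast]
          have hl' : l ≤ R := by have := Finset.mem_range.1 hl; omega
          calc ‖h‖ ^ l / (l.factorial : ℝ) ≤ ‖h‖ ^ l :=
                div_le_self (by positivity) (by exact_mod_cast l.factorial_pos)
            _ ≤ M ^ l := by gcongr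
            _ ≤ M ^ R := pow_le_pow_right₀ hM1 hl'
      _ = _ := by simp
  have hyy : (1 + y) ^ (R * R) ≤ 2 ^ (R * R) * (1 + y ^ 2) ^ (R * R) := by
    rw [← mul_pow]
    gcongr
    nlinarith [sq_nonneg (y - 1)]
  have hsv : s * v ^ 2 / 2 = S * y ^ 2 / 2 := by rw [hsS, hy]; ring
  -- With `y² ≥ 1/256` and `S ≥ 1`, the exponent pays for the powers of `1 + S`, for the powers of
  -- `1 + y²`, and for the required decay `S/1024`.
  have hexp : Real.exp (-(S * y ^ 2 / 2))
      ≤ Real.exp (-(1 / 2048 * S)) * Real.exp (-(1 / 8 * y ^ 2)) * Real.exp (-(S / 1024)) := by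
    rw [← Real.exp_add, ← Real.exp_add]
    apply Real.exp_le_exp.2
    have h1 : 1 / 256 ≤ y ^ 2 := by nlinarith
    have h3 : S * (1 / 256) ≤ S * y ^ 2 := by gcongr
    have h4 : 1 * y ^ 2 ≤ S * y ^ 2 := by gcongr
    linarith
  rw [hsv]
  have hS0 : 0 ≤ S := by linarith
  calc Real.exp (-(S * y ^ 2 / 2)) * ‖∑ l ∈ Finset.range (R + 1), h ^ l / (l.factorial : ℂ)‖
      ≤ (Real.exp (-(1 / 2048 * S)) * Real.exp (-(1 / 8 * y ^ 2)) * Real.exp (-(S / 1024)))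
        * ((R + 1) * ((1 + R) ^ R * (1 + S) ^ R * (2 ^ (R * R) * (1 + y ^ 2) ^ (R * R)))) := by
        gcongr
        refine hH.trans ?_
        rw [hM, mul_pow, mul_pow, ← pow_mul]
        gcongr
        linarith
    _ = (R + 1) * ((1 + R) ^ R * 2 ^ (R * R)) * ((1 + S) ^ R * Real.exp (-(1 / 2048 * S)))
        * ((1 + y ^ 2) ^ (R * R) * Real.exp (-(1 / 8 * y ^ 2))) * Real.exp (-(S / 1024)) := by ring
    _ ≤ (R + 1) * ((1 + R) ^ R * 2 ^ (R * R)) * K₁ * K₂ * Real.exp (-(S / 1024)) := by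
        gcongr
        · exact hKb₁ S hS0
        · exact hKb₂ (y ^ 2) (by positivity)

/-- The local estimate in terms of the moments `a_{n,1}`, `a_{n,2}` and an upper bound `B` for the
ratios `(n - k) / k`. -/
theorem exists_abs_couponLaw_sub_nuR_le {R : ℕ} (hR : 3 ≤ R) :
    ∃ K : ℝ, 0 < K ∧ ∀ (n m : ℕ) (B s : ℝ), m < n → 1 ≤ B →
      (∀ k ∈ Finset.Icc (m + 1) n, ((n : ℝ) - k) / k ≤ B) →
      s = aCoef n m 1 + aCoef n m 2 → 1 ≤ s / B ^ 2 →
      ∀ {Ω : Type*} [MeasurableSpace Ω] (P : Measure Ω) [IsProbabilityMeasure P]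
        (X : ℕ → Ω → Fin n), IsUniformSampling P n X → ∀ k : ℤ,
        |(couponLaw P m X).real {k} - nuR P m X R {k}|
          ≤ K * ((1 / √s) ^ (R + 2) * (aCoef n m 2 * B ^ (R - 1) + B ^ (R + 1))
            + Real.exp (-(s / B ^ 2 / 1024))) := by
  obtain ⟨K₁, hK₁, hKb₁⟩ := exists_norm_transform_sub_le_of_small hR
  obtain ⟨K₂, hK₂, hKb₂⟩ := exists_norm_exp_mul_HPoly_le hR
  refine ⟨K₁ * √(16 * Real.pi) + (1 + K₂), by positivity, ?_⟩
  intro n m B s hm hB hx hs hS Ω _ P _ X hX k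
  have hB0 : 0 < B := by linarith
  have hs0 : 0 < s := by
    have : 0 < s / B ^ 2 := by linarith
    exact (div_pos_iff_of_pos_right (by positivity)).1 this
  have hpi := Real.pi_pos
  have hvar : ((waitVar P m X).toNNReal : ℝ) = s := by
    rw [Real.coe_toNNReal', waitVar_eq hX hm, ← hs, max_eq_left hs0.le]
  have hlam : 0 < (waitVar P m X).toNNReal := by
    rw [← NNReal.coe_pos, hvar]; exact hs0
  set T := (1 / √s) ^ (R + 1) * (aCoef n m 2 * B ^ (R - 1) + B ^ (R + 1)) with hT
  have hT0 : 0 ≤ T := by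
    have := aCoef_nonneg n m 2
    positivity
  set D := Real.exp (-(s / B ^ 2 / 1024)) with hD
  have hD0 : 0 < D := Real.exp_pos _
  have hF : ∀ t : ℝ, HasSum (fun k : ℤ => Complex.exp (Complex.I * t * k)
      * (((couponLaw P m X).real {k} - nuR P m X R {k} : ℝ) : ℂ)) _ := fun t => by
    have h1 := (hasSum_couponLaw hX hm t).sub (hasSum_poissonCharlier _ hlam (HPoly n m R) t)
    simp only [← mul_sub, ← Complex.ofReal_sub] at h1
    exact h1
  have hbound := norm_le_integral_of_hasSum_exp hF
    (g := fun t => K₁ * T * Real.exp (-(s / 16) * t ^ 2) + (1 + K₂) * D) (by fun_prop) (by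
      intro t ht
      rw [hvar]
      have hw := norm_one_add_exp_I_sub_one t
      have hvt := norm_exp_I_sub_one_ge ht
      set w := Complex.exp (Complex.I * t) - 1
      rcases le_total (B * ‖w‖) (1 / 16) with hsm | hlg
      · refine (hKb₁ n m B s hB hx hs hs0 w hw hsm).trans ?_
        refine le_add_of_le_of_nonneg ?_ (by positivity)
        gcongr
        -- This turns the Gaussian in `‖w‖` into one in `t`, with rate `s/16`.
        have : t ^ 2 / 4 ≤ ‖w‖ ^ 2 := by
          rw [← sq_abs t]
          nlinarith [abs_nonneg t]
        nlinarith
      · refine (norm_sub_le _ _).trans ?_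
        have h1 := norm_prod_inv_le hB hx hs hw hlg
        have h2 := hKb₂ n m B s hB hx hs hS w hw hlg
        have h3 : 0 ≤ K₁ * T * Real.exp (-(s / 16) * t ^ 2) := by positivity
        linarith) k
  rw [Complex.norm_real, Real.norm_eq_abs] at hbound
  refine hbound.trans ?_
  -- The Gaussian integral supplies the extra factor `1/√s` that raises the exponent from `R + 1` to
  -- `R + 2`.
  have hint : ∫ t in (-Real.pi)..Real.pi, Real.exp (-(s / 16) * t ^ 2) ≤ √(16 * Real.pi) * (1 / √s) := by
    rw [intervalIntegral.integral_of_le (by linarith)]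
    refine (setIntegral_le_integral (integrable_exp_neg_mul_sq (by positivity))
      (Filter.Eventually.of_forall fun t => (Real.exp_pos _).le)).trans ?_
    rw [integral_gaussian, ← Real.sqrt_one, ← Real.sqrt_div zero_le_one, ← Real.sqrt_mul (by positivity)]
    apply le_of_eq
    congr 1
    field_simp
  rw [intervalIntegral.integral_add (Continuous.intervalIntegrable (by fun_prop) _ _)
    (Continuous.intervalIntegrable (by fun_prop) _ _), intervalIntegral.integral_const_mul,
    intervalIntegral.integral_const, smul_eq_mul]
  have h2pi : 1 / (2 * Real.pi) ≤ 1 := by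
    rw [div_le_one (by positivity)]; linarith [Real.pi_gt_three]
  have hi0 : 0 ≤ ∫ t in (-Real.pi)..Real.pi, Real.exp (-(s / 16) * t ^ 2) :=
    intervalIntegral.integral_nonneg (by linarith) fun _ _ => (Real.exp_pos _).le
  set J := ∫ t in (-Real.pi)..Real.pi, Real.exp (-(s / 16) * t ^ 2)
  calc 1 / (2 * Real.pi) * (K₁ * T * J + (Real.pi - -Real.pi) * ((1 + K₂) * D))
      = 1 / (2 * Real.pi) * (K₁ * T * J) + (1 + K₂) * D := by field_simp; ring
    _ ≤ 1 * (K₁ * T * (√(16 * Real.pi) * (1 / √s))) + (1 + K₂) * D := by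
        gcongr
    _ = K₁ * √(16 * Real.pi) * ((1 / √s) ^ (R + 2) * (aCoef n m 2 * B ^ (R - 1) + B ^ (R + 1)))
        + (1 + K₂) * D := by rw [hT]; ring
    _ ≤ _ := by
        have e1 : 0 ≤ (1 / √s) ^ (R + 2) * (aCoef n m 2 * B ^ (R - 1) + B ^ (R + 1)) := by
          have := aCoef_nonneg n m 2
          positivity
        have e2 : 0 ≤ K₁ * √(16 * Real.pi) := by positivity
        nlinarith [mul_nonneg e2 hD0.le, mul_nonneg (by linarith : 0 ≤ 1 + K₂) e1]

/-! ### Size of the moments -/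

theorem le_aCoef {n m j r : ℕ} (hj : m + j ≤ n) {c : ℝ} (hc : 0 ≤ c)
    (h : ∀ k ∈ Finset.Icc (m + 1) (m + j), c ≤ ((n : ℝ) - k) / k) : j * c ^ r ≤ aCoef n m r := by
  have hsub : Finset.Icc (m + 1) (m + j) ⊆ Finset.Icc (m + 1) n :=
    Finset.Icc_subset_Icc_right hj
  calc (j : ℝ) * c ^ r = ∑ k ∈ Finset.Icc (m + 1) (m + j), c ^ r := by simp
    _ ≤ ∑ k ∈ Finset.Icc (m + 1) (m + j), (((n : ℝ) - k) / k) ^ r :=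
        Finset.sum_le_sum fun k hk => pow_le_pow_left₀ hc (h k hk) r
    _ ≤ aCoef n m r := Finset.sum_le_sum_of_subset_of_nonneg hsub fun k hk _ =>
        pow_nonneg (ratio_nonneg hk) _

theorem quarter_le_half {d : ℕ} (hd : 2 ≤ d) : (d : ℝ) / 4 ≤ (d / 2 : ℕ) := by
  have : d ≤ 4 * (d / 2) := by omega
  have h : (d : ℝ) ≤ 4 * (d / 2 : ℕ) := by exact_mod_cast this
  linarith

/-- Among the first `m/2` indices `k ≤ 3m/2` and `n - k ≥ n/4`, so each ratio is at least `n/(6m)`;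
at least `m/4` such terms give the constant `4 · 36 = 144`. -/
theorem le_aCoef_two_of_le_half {n m : ℕ} (hm : 2 ≤ m) (hmn : 2 * m ≤ n) :
    (n : ℝ) ^ 2 / (144 * m) ≤ aCoef n m 2 := by
  have hm0 : (0 : ℝ) < m := by exact_mod_cast (by omega : 0 < m)
  have hmn' : 2 * (m : ℝ) ≤ n := by exact_mod_cast hmn
  have h := le_aCoef (n := n) (m := m) (j := m / 2) (r := 2) (by omega)
    (c := n / (6 * m)) (by positivity) (by
      intro k hk
      obtain ⟨h1, h2⟩ := Finset.mem_Icc.1 hk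
      have hk0 : (0 : ℝ) < k := by exact_mod_cast (by omega : 0 < k)
      have hk2 : 2 * (k : ℝ) ≤ 3 * m := by exact_mod_cast (by omega : 2 * k ≤ 3 * m)
      rw [div_le_div_iff₀ (by positivity) hk0]
      nlinarith)
  refine le_trans ?_ h
  calc (n : ℝ) ^ 2 / (144 * m) = m / 4 * (n / (6 * m)) ^ 2 := by field_simp; ring
    _ ≤ _ := by
      gcongr
      exact quarter_le_half hm

theorem aCoef_two_le_of_half_le {n m : ℕ} (hm : m < n) (hmn : n ≤ 2 * m) :
    aCoef n m 2 ≤ 4 * ((n : ℝ) - m) ^ 3 / n ^ 2 := by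
  have hn0 : (0 : ℝ) < n := by exact_mod_cast (by omega : 0 < n)
  have hmn' : (m : ℝ) < n := by exact_mod_cast hm
  have hmn2 : (n : ℝ) ≤ 2 * m := by exact_mod_cast hmn
  calc aCoef n m 2 ≤ ∑ k ∈ Finset.Icc (m + 1) n, (2 * ((n : ℝ) - m) / n) ^ 2 := by
        refine Finset.sum_le_sum fun k hk => pow_le_pow_left₀ (ratio_nonneg hk) ?_ 2
        obtain ⟨h1, h2⟩ := Finset.mem_Icc.1 hk
        have hk0 : (0 : ℝ) < k := by exact_mod_cast (by omega : 0 < k)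
        have hk1 : (m : ℝ) ≤ k := by exact_mod_cast (by omega : m ≤ k)
        rw [div_le_div_iff₀ hk0 hn0]
        have e1 : ((n : ℝ) - k) * n ≤ (n - m) * n := by gcongr
        have e2 : ((n : ℝ) - m) * n ≤ (n - m) * (2 * k) :=
          mul_le_mul_of_nonneg_left (by linarith) (by linarith)
        linarith
    _ = 4 * ((n : ℝ) - m) ^ 3 / n ^ 2 := by
        rw [Finset.sum_const, Nat.card_Icc, nsmul_eq_mul, show n + 1 - (m + 1) = n - m by omega,
          Nat.cast_sub hm.le]
        ring

theorem le_aCoef_one {n m : ℕ} (hm : m + 2 ≤ n) :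
    ((n : ℝ) - m) ^ 2 / (8 * n) ≤ aCoef n m 1 := by
  have hn0 : (0 : ℝ) < n := by exact_mod_cast (by omega : 0 < n)
  have hmn' : (m : ℝ) < n := by exact_mod_cast (by omega : m < n)
  have hc0 : 0 ≤ ((n : ℝ) - m) / (2 * n) := div_nonneg (by linarith) (by positivity)
  have h := le_aCoef (n := n) (m := m) (j := (n - m) / 2) (r := 1) (by omega) hc0 (by
      intro k hk
      obtain ⟨h1, h2⟩ := Finset.mem_Icc.1 hk
      have hk0 : (0 : ℝ) < k := by exact_mod_cast (by omega : 0 < k)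
      have hkn : (k : ℝ) ≤ n := by exact_mod_cast (by omega : k ≤ n)
      have hk2 : 2 * (k : ℝ) ≤ n + m := by exact_mod_cast (by omega : 2 * k ≤ n + m)
      rw [div_le_div_iff₀ (by positivity) hk0]
      have e1 : ((n : ℝ) - m) * k ≤ (n - m) * n :=
        mul_le_mul_of_nonneg_left hkn (by linarith)
      have e2 : ((n : ℝ) - m) * n ≤ (2 * (n - k)) * n := by gcongr; linarith
      linarith)
  refine le_trans ?_ h
  have hq := quarter_le_half (d := n - m) (by omega)
  rw [Nat.cast_sub (by omega)] at hq
  calc ((n : ℝ) - m) ^ 2 / (8 * n) = ((n : ℝ) - m) / 4 * (((n : ℝ) - m) / (2 * n)) ^ 1 := by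
        field_simp; ring
    _ ≤ _ := by gcongr

/-! ### The two regimes -/

/-- Here `B = n/m` and `1/√s ≤ 12√m/n`. Trading `a ≤ s` for two factors `1/√s`, the first term is of
order `m^{-R/2}` times `m/n`, and the second is of order `m^{-R/2}` times `1/n`. The exponential is
at most `exp(-m/(144 · 1024))`. -/
theorem exists_bound_of_le_half (R : ℕ) (hR : 1 ≤ R) : ∃ K : ℝ, 0 < K ∧ ∀ (n m : ℕ) (a s : ℝ),
    1 ≤ m → m ≤ n → 0 ≤ a → (n : ℝ) ^ 2 / (144 * m) ≤ s → a ≤ s →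
    (1 / √s) ^ (R + 2) * (a * ((n : ℝ) / m) ^ (R - 1) + ((n : ℝ) / m) ^ (R + 1))
      + Real.exp (-(s / ((n : ℝ) / m) ^ 2 / 1024)) ≤ K * (1 / √(m : ℝ)) ^ R := by
  obtain ⟨K, hK, hKb⟩ := exists_one_add_pow_mul_exp_neg_le R (κ := 1 / (144 * 1024)) (by norm_num)
  refine ⟨12 ^ R + 12 ^ (R + 2) + K, by positivity, ?_⟩
  intro n m a s hm hmn ha hs has
  have hm1 : (1 : ℝ) ≤ m := by exact_mod_cast hm
  have hmn' : (m : ℝ) ≤ n := by exact_mod_cast hmn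
  have hn0 : (0 : ℝ) < n := by linarith
  have hs0 : 0 < s := lt_of_lt_of_le (by positivity) hs
  have hexp : Real.exp (-(s / ((n : ℝ) / m) ^ 2 / 1024)) ≤ K * (1 / √(m : ℝ)) ^ R := by
    have h1 : (m : ℝ) / 144 ≤ s / ((n : ℝ) / m) ^ 2 := by
      rw [le_div_iff₀ (by positivity)]
      refine le_trans (le_of_eq ?_) hs
      field_simp
    have h2 : Real.exp (-(s / ((n : ℝ) / m) ^ 2 / 1024)) ≤ Real.exp (-(1 / (144 * 1024) * m)) :=
      Real.exp_le_exp.2 (by linarith)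
    have h3 := hKb m (by linarith)
    have h4 : √(m : ℝ) ≤ 1 + m := (Real.sqrt_le_left (by linarith)).2 (by nlinarith)
    rw [one_div, inv_pow, ← div_eq_mul_inv, le_div_iff₀ (by positivity), mul_comm]
    calc √(m : ℝ) ^ R * Real.exp (-(s / ((n : ℝ) / m) ^ 2 / 1024))
        ≤ (1 + m) ^ R * Real.exp (-(1 / (144 * 1024) * m)) := by gcongr
      _ ≤ K := h3
  have hq0 : 0 < √(m : ℝ) := Real.sqrt_pos.2 (by linarith)
  have hqq : √(m : ℝ) ^ 2 = m := Real.sq_sqrt (by linarith)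
  have hr0 : 0 < √s := Real.sqrt_pos.2 hs0
  have hrr : √s ^ 2 = s := Real.sq_sqrt hs0.le
  set q := √(m : ℝ)
  have hinv : 1 / √s ≤ 12 * q / n := by
    rw [div_le_div_iff₀ hr0 hn0, one_mul]
    refine le_of_sq_le_sq ?_ (by positivity)
    rw [mul_pow, hrr, mul_pow, hqq]
    rw [div_le_iff₀ (by positivity)] at hs
    linarith
  have h1 : (1 / √s) ^ (R + 2) * (a * ((n : ℝ) / m) ^ (R - 1)) ≤ 12 ^ R * (1 / q) ^ R := by
    obtain ⟨j, rfl⟩ := Nat.exists_eq_add_of_le hR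
    rw [Nat.add_sub_cancel_left]
    calc (1 / √s) ^ (1 + j + 2) * (a * ((n : ℝ) / m) ^ j)
        ≤ (1 / √s) ^ (1 + j + 2) * (√s ^ 2 * ((n : ℝ) / m) ^ j) := by
          rw [hrr]; gcongr
      _ = (1 / √s) ^ (1 + j) * ((n : ℝ) / m) ^ j := by
          rw [pow_add _ (1 + j) 2]; field_simp
      _ ≤ (12 * q / n) ^ (1 + j) * ((n : ℝ) / m) ^ j := by gcongr
      _ = 12 ^ (1 + j) * (1 / q) ^ (1 + j) * (m / n) := by
          rw [← hqq]
          simp only [div_pow, mul_pow, one_pow, ← pow_mul]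
          field_simp
          ring
      _ ≤ 12 ^ (1 + j) * (1 / q) ^ (1 + j) * 1 := by
          gcongr
          exact (div_le_one hn0).2 hmn'
      _ = _ := mul_one _
  have h2 : (1 / √s) ^ (R + 2) * ((n : ℝ) / m) ^ (R + 1) ≤ 12 ^ (R + 2) * (1 / q) ^ R := by
    calc (1 / √s) ^ (R + 2) * ((n : ℝ) / m) ^ (R + 1)
        ≤ (12 * q / n) ^ (R + 2) * ((n : ℝ) / m) ^ (R + 1) := by gcongr
      _ = 12 ^ (R + 2) * (1 / q) ^ R * (1 / n) := by
          rw [← hqq]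
          simp only [div_pow, mul_pow, one_pow, ← pow_mul]
          field_simp
          ring
      _ ≤ 12 ^ (R + 2) * (1 / q) ^ R * 1 := by
          gcongr
          exact (div_le_one hn0).2 (by linarith)
      _ = _ := mul_one _
  rw [mul_add]
  linarith

/-- Here `B = 1`, `d` stands for `n - m`, and `1/√s ≤ 3√n/d`. As `a > 1`, `a + 1 ≤ 2a ≤ 8d³/n²`, and
multiplying by `(3√n/d)^{R+2}` gives exactly the stated rate. -/
theorem exists_bound_of_half_le (R : ℕ) (hR : 3 ≤ R) : ∃ K : ℝ, 0 < K ∧ ∀ (n a s d : ℝ),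
    1 ≤ n → 0 < d → d ≤ n → 1 < a → a ≤ 4 * d ^ 3 / n ^ 2 → d ^ 2 / (8 * n) ≤ s →
    (1 / √s) ^ (R + 2) * (a + 1) + Real.exp (-(s / 1024))
      ≤ K * (√n ^ (R - 2) / d ^ (R - 1)) := by
  obtain ⟨K, hK, hKb⟩ := exists_one_add_pow_mul_exp_neg_le (3 * R) (κ := 1 / 1024) (by norm_num)
  refine ⟨8 * 3 ^ (R + 2) + K * 8192 ^ R, by positivity, ?_⟩
  intro n a s d hn hd hdn ha had hs
  have hn0 : 0 < n := by linarith
  have hs0 : 0 < s := lt_of_lt_of_le (by positivity) hs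
  have hp0 : 0 < √n := Real.sqrt_pos.2 hn0
  have hp1 : 1 ≤ √n := Real.one_le_sqrt.2 hn
  have hpp : √n ^ 2 = n := Real.sq_sqrt hn0.le
  have hr0 : 0 < √s := Real.sqrt_pos.2 hs0
  have hrr : √s ^ 2 = s := Real.sq_sqrt hs0.le
  set p := √n
  have hinv : 1 / √s ≤ 3 * p / d := by
    rw [div_le_div_iff₀ hr0 hd, one_mul]
    refine le_of_sq_le_sq ?_ (by positivity)
    rw [mul_pow, hrr, mul_pow, hpp]
    rw [div_le_iff₀ (by positivity)] at hs
    have : 0 < s * n := by positivity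
    linarith
  have h1 : (1 / √s) ^ (R + 2) * (a + 1) ≤ 8 * 3 ^ (R + 2) * (p ^ (R - 2) / d ^ (R - 1)) := by
    obtain ⟨j, rfl⟩ := Nat.exists_eq_add_of_le hR
    rw [show 3 + j - 2 = j + 1 by omega, show 3 + j - 1 = j + 2 by omega]
    calc (1 / √s) ^ (3 + j + 2) * (a + 1)
        ≤ (3 * p / d) ^ (3 + j + 2) * (2 * (4 * d ^ 3 / n ^ 2)) := by
          gcongr; linarith
      _ = _ := by
          rw [← hpp]
          simp only [div_pow, mul_pow, ← pow_mul]
          field_simp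
          ring
  -- The condition `a > 1` forces `d` to be at least of order `n^{2/3}`. Then `s` is at least of
  -- order `n^{1/3}`, and the exponential term is smaller than any power of `1/n`.
  have hnd : n ^ 2 ≤ 4 * d ^ 3 := by
    have := ha.le.trans had
    rwa [one_le_div (by positivity)] at this
  have hs3 : n / 8192 ≤ s ^ 3 := by
    calc n / 8192 = (n ^ 2) ^ 2 / (8192 * n ^ 3) := by field_simp
      _ ≤ (4 * d ^ 3) ^ 2 / (8192 * n ^ 3) := by gcongr
      _ = (d ^ 2 / (8 * n)) ^ 3 := by field_simp; norm_num
      _ ≤ s ^ 3 := by gcongr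
  have hexp : Real.exp (-(s / 1024)) ≤ K * 8192 ^ R * (1 / n ^ R) := by
    have h2 := hKb s hs0.le
    have h3 : (n / 8192) ^ R ≤ (1 + s) ^ (3 * R) := by
      rw [pow_mul]
      gcongr
      exact hs3.trans (by gcongr; linarith)
    have h4 : (n / 8192) ^ R * Real.exp (-(s / 1024)) ≤ K := by
      calc _ ≤ (1 + s) ^ (3 * R) * Real.exp (-(s / 1024)) := by gcongr
        _ = (1 + s) ^ (3 * R) * Real.exp (-(1 / 1024 * s)) := by congr 2; ring
        _ ≤ K := h2
    rw [mul_one_div, le_div_iff₀ (by positivity)]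
    rw [div_pow, div_mul_eq_mul_div, div_le_iff₀ (by positivity)] at h4
    linarith
  have htarget : 1 / n ^ R ≤ p ^ (R - 2) / d ^ (R - 1) := by
    gcongr
    · exact one_le_pow₀ hp1
    · calc d ^ (R - 1) ≤ n ^ (R - 1) := by gcongr
        _ ≤ n ^ R := pow_le_pow_right₀ hn (by omega)
  have h5 : K * 8192 ^ R * (1 / n ^ R) ≤ K * 8192 ^ R * (p ^ (R - 2) / d ^ (R - 1)) := by gcongr
  linarith

theorem theorem7p1 (R : ℕ) (hR : 3 ≤ R) :
    ∃ (mR nR : ℕ) (CR : ℝ), 0 < CR ∧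
      ∀ (n m : ℕ), nR ≤ n → mR ≤ m → m < n → 1 < aCoef n m 2 →
        ∀ {Ω : Type*} [MeasurableSpace Ω] (P : Measure Ω) [IsProbabilityMeasure P]
          (X : ℕ → Ω → Fin n), IsUniformSampling P n X →
          ((m : ℝ) ≤ (n : ℝ) / 2 - 1 → ∀ k : ℤ,
              |(couponLaw P m X).real {k} - nuR P m X R {k}| ≤ CR * (1 / √(m : ℝ)) ^ R) ∧
          ((n : ℝ) / 2 ≤ (m : ℝ) → ∀ k : ℤ,
              |(couponLaw P m X).real {k} - nuR P m X R {k}|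
                ≤ CR * ((√(n : ℝ)) ^ (R - 2) / ((n : ℝ) - (m : ℝ)) ^ (R - 1))) := by
  obtain ⟨K, hK, hKb⟩ := exists_abs_couponLaw_sub_nuR_le hR
  obtain ⟨K₁, hK₁, hKb₁⟩ := exists_bound_of_le_half R (by omega)
  obtain ⟨K₂, hK₂, hKb₂⟩ := exists_bound_of_half_le R hR
  -- `m ≥ 144` makes `s/B² ≥ m/144 ≥ 1` when `B = n/m`. When `B = 1`, the same requirement follows
  -- from `a_{n,2} > 1`.
  refine ⟨144, 2, K * (K₁ + K₂), by positivity, ?_⟩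
  intro n m hn hm hmn ha Ω _ P _ X hX
  have hn0 : (2 : ℝ) ≤ n := by exact_mod_cast hn
  have hm0 : (144 : ℝ) ≤ m := by exact_mod_cast hm
  have hmn' : (m : ℝ) < n := by exact_mod_cast hmn
  have ha1 := aCoef_nonneg n m 1
  refine ⟨fun h k => ?_, fun h k => ?_⟩
  · have h2m : 2 * m ≤ n := by
      have : 2 * (m : ℝ) ≤ n := by linarith
      exact_mod_cast this
    have ha2 := le_aCoef_two_of_le_half (n := n) (m := m) (by omega) h2m
    refine (hKb n m (n / m) _ hmn ?_ ?_ rfl ?_ P X hX k).trans ?_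
    · rw [one_le_div (by linarith)]; exact hmn'.le
    · intro k hk
      obtain ⟨h1, h2⟩ := Finset.mem_Icc.1 hk
      have hk1 : (m : ℝ) ≤ k := by exact_mod_cast (by omega : m ≤ k)
      gcongr
      linarith
    · rw [le_div_iff₀ (by positivity)]
      have : 1 * ((n : ℝ) / m) ^ 2 ≤ (n : ℝ) ^ 2 / (144 * m) := by
        rw [one_mul, div_pow]
        gcongr
        nlinarith
      linarith
    · rw [mul_assoc]
      gcongr
      refine (hKb₁ n m (aCoef n m 2) _ (by omega) hmn.le (by linarith) (by linarith)
        (by linarith)).trans ?_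
      gcongr
      linarith
  · have h2m : n ≤ 2 * m := by
      have : (n : ℝ) ≤ 2 * m := by linarith
      exact_mod_cast this
    have ha2 := aCoef_two_le_of_half_le hmn h2m
    -- If `n = m + 1`, the upper bound `4/n²` for `a_{n,2}` contradicts `a_{n,2} > 1`.
    have hd : m + 2 ≤ n := by
      by_contra hlt
      have e : n = m + 1 := by omega
      have e' : (n : ℝ) - m = 1 := by rw [e]; push_cast; ring
      rw [e', le_div_iff₀ (by positivity)] at ha2
      nlinarith
    have hone := le_aCoef_one hd
    have hfin := hKb₂ n (aCoef n m 2) (aCoef n m 1 + aCoef n m 2) (n - m) (by linarith)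
      (by linarith) (by linarith) ha ha2 (by linarith)
    refine (hKb n m 1 _ hmn le_rfl ?_ rfl ?_ P X hX k).trans ?_
    · intro k hk
      obtain ⟨h1, h2⟩ := Finset.mem_Icc.1 hk
      have hk1 : (n : ℝ) ≤ 2 * k := by exact_mod_cast (by omega : n ≤ 2 * k)
      rw [div_le_one (by linarith)]
      linarith
    · rw [one_pow, div_one]; linarith
    · simp only [one_pow, mul_one, div_one]
      rw [mul_assoc]
      have hdn : 0 < (n : ℝ) - m := by linarith
      gcongr
      refine hfin.trans ?_
      gcongr
      linarith
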